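/- Let $p$ be a prime, $G=\mathbb{Q}_p^+$ the additive group of $\mathbb{Q}_p$, $G_n=p^n\mathbb{Z}_p$ ($n\in\mathbb{Z}$), $X$ the group of continuous unitary characters of $G$, and $G_n^\perp\subset X$ the annihilator of $G_n$. Let $\mu,\nu$ be the Haar measures on $G$ and $X$ with $\mu(G_0)=\nu(G_0^\perp)=1$, and let $\hat f\in L_2(X)$ be the Fourier transform of $f\in L_2(G)$, i.e. $\hat f(\chi)=\lim_{n\to\infty}\int_{G_{-n}}f(x)\overline{(\chi,x)}\,d\mu(x)$ with the limit in $L_2(X)$. Put $\mathcal{A}x=p^{-1}x$ and $(\chi\mathcal{A},x)=(\chi,\mathcal{A}x)$, and let $H_0$ be the set of all finite sums $a_{-1}p^{-1}+\dots+a_{-s}p^{-s}$ with $a_{-k}\in\{0,\dots,p-1\}$. A function $\varphi\in L_2(G)$ is refinable if $\varphi(x)=p\sum_{h\in H_0}\beta_h\varphi(\mathcal{A}x-h)$ for some $(\beta_h)\in\ell^2(H_0)$; a mask is a function $m(\chi)=\sum_{h\in H_0}\beta_h\overline{(\chi\mathcal{A}^{-1},h)}$ with $(\beta_h)\in\ell^2(H_0)$,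 the series converging in $L_2(G_k^\perp)$ for every $k\in\mathbb{Z}$. **Theorem 3.1.** Let $M\ge 1$ and $N\ge 0$ be integers. Let $\varphi\in L_2(G)$ be a refinable function that vanishes outside $G_{-N}$ and is constant on the cosets of $G_M$ (that is, $\varphi\in\mathfrak{D}_{G_M}(G_{-N})$). Let $m_1,\dots,m_q$ be masks and $\psi^{(1)},\dots,\psi^{(q)}\in L_2(G)$ functions such that $$\hat\psi^{(j)}(\chi)=\hat\varphi(\chi\mathcal{A}^{-1})\,m_j(\chi)=\mathbf{1}_{E_j}(\chi)\quad\text{for almost every }\chi,$$ where $E_j\subset G_{M+1}^\perp$ is a coset of $G_{-s(j)}^\perp$ for some integer $s(j)\ge 0$. Let $t(1),\dots,t(q)\ge 0$ be integers such that the sets $E_j\mathcal{A}^{t(j)}$ are pairwise disjoint and $$\bigsqcup_{j=1}^q E_j\mathcal{A}^{t(j)}=G_{M+1}^\perp\setminus G_M^\perp .$$ Put $l=\max_j t(j)$ and $\psi^{(j)}_{n,h}(x)=p^{n/2}\psi^{(j)}(\mathcal{A}^n x-h)$. Then for every $f\in L_2(G)$ and every integer $\tilde N>N$ the series $\sum_{n=-\infty}^{\tilde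 N}\sum_{j=1}^q\sum_{h\in H_0}\langle f,\psi^{(j)}_{n,h}\rangle\psi^{(j)}_{n,h}$ converges unconditionally in $L_2(G)$, and $$\Bigl\|f-\sum_{n=-\infty}^{\tilde N}\sum_{j=1}^q\sum_{h\in H_0}\langle f,\psi^{(j)}_{n,h}\rangle\psi^{(j)}_{n,h}\Bigr\|_2\le (N+1)\,p^{\frac{M-1}{2}}\sum_{n=\tilde N+1}^{\infty}\Bigl(\int_{G_{n-l+1}^\perp\setminus G_{n-l}^\perp}|\hat f(\chi)|^2\,d\nu(\chi)\Bigr)^{1/2},$$ where the right-hand side may be $+\infty$. -/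

import Mathlib

open MeasureTheory Filter Topology
open scoped ENNReal ComplexConjugate

noncomputable section

namespace PadicFrame

instance instMeasurableSpacePadic (p : ℕ) [Fact p.Prime] : MeasurableSpace ℚ_[p] := borel _

instance instBorelSpacePadic (p : ℕ) [Fact p.Prime] : BorelSpace ℚ_[p] := ⟨rfl⟩

/-- The group `X` of (continuous, unitary) characters of the additive group `G` of `ℚ_p`, with
multiplication of characters as group law and the topology of the Pontryagin dual. -/
abbrev X (p : ℕ) [Fact p.Prime] : Type := PontryaginDual (Multiplicative ℚ_[p])

instance instMeasurableSpaceX (p : ℕ) [Fact p.Prime] : MeasurableSpace (X p) := borel _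

instance instBorelSpaceX (p : ℕ) [Fact p.Prime] : BorelSpace (X p) := ⟨rfl⟩

section

variable {p : ℕ} [Fact p.Prime]

/-- The value `(χ, x)` of the character `χ` at the point `x`. -/
def pair (χ : X p) (x : ℚ_[p]) : ℂ := (χ (Multiplicative.ofAdd x) : Circle)

variable (p) in
/-- The subgroup `G_n = p ^ n ℤ_p` of `ℚ_p`, as a set. -/
def G (n : ℤ) : Set ℚ_[p] := {x | ‖x‖ ≤ (p : ℝ) ^ (-n)}

variable (p) in
/-- The annihilator `G_n^⊥` of `G_n`, as a set of characters. -/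
def Gperp (n : ℤ) : Set (X p) := {χ | ∀ x ∈ G p n, pair χ x = 1}

variable (p) in
/-- The Haar measure on `ℚ_p` with `μ (G_0) = 1` (so that `μ (G_n) = p ^ (-n)`). -/
def μ : Measure ℚ_[p] :=
  ((Measure.addHaar : Measure ℚ_[p]) (G p 0))⁻¹ • (Measure.addHaar : Measure ℚ_[p])

variable (p) in
/-- The Haar measure on `X` with `ν (G_0^⊥) = 1` (so that `ν (G_n^⊥) = p ^ n`). -/
def ν : Measure (X p) :=
  ((Measure.haar : Measure (X p)) (Gperp p 0))⁻¹ • (Measure.haar : Measure (X p))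

/-- The power `A ^ n`, `n ∈ ℤ`, of the dilation `A`, where `A (∑ a_k p ^ k) = ∑ a_k p ^ (k - 1)`;
that is, `A x = p⁻¹ x`. -/
def dil (n : ℤ) (x : ℚ_[p]) : ℚ_[p] := (p : ℚ_[p]) ^ (-n) * x

variable (p) in
/-- `A ^ n` as a continuous homomorphism of the additive group of `ℚ_p` (written
multiplicatively). -/
def dilHom (n : ℤ) : Multiplicative ℚ_[p] →ₜ* Multiplicative ℚ_[p] where
  toFun x := Multiplicative.ofAdd (dil n x.toAdd)
  map_one' := by simp [dil]
  map_mul' x y := by simp [dil, mul_add]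
  continuous_toFun := by
    unfold dil
    exact continuous_ofAdd.comp (continuous_const.mul continuous_toAdd)

/-- The dilated character `χ A ^ n`, given by `(χ A ^ n, x) = (χ, A ^ n x)`. -/
def dilChar (n : ℤ) (χ : X p) : X p := PontryaginDual.map (dilHom p n) χ

theorem pair_dilChar (n : ℤ) (χ : X p) (x : ℚ_[p]) :
    pair (dilChar n χ) x = pair χ (dil n x) := rfl

variable (p) in
/-- The set `H_0` of all sums `a_{-1} p ^ (-1) + a_{-2} p ^ (-2) + ... + a_{-s} p ^ (-s)` with
digits `a_{-k} ∈ {0, ..., p - 1}`. -/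
def H0 : Set ℚ_[p] :=
  {h | ∃ (s : ℕ) (a : ℕ → ℕ), (∀ k, a k < p) ∧
    h = ∑ k ∈ Finset.Icc 1 s, (a k : ℚ_[p]) * (p : ℚ_[p]) ^ (-(k : ℤ))}

/-- The family `u` of functions is unconditionally summable in `L_2(m)`, with sum `S`. -/
def HasSumL2 {ι α : Type*} [MeasurableSpace α] (u : ι → α → ℂ) (S : α → ℂ) (m : Measure α) :
    Prop :=
  MemLp S 2 m ∧
    Tendsto (fun F : Finset ι => eLpNorm (fun x => S x - ∑ i ∈ F, u i x) 2 m) atTop (𝓝 0)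

/-- `F` is (a representative of) the Fourier transform of `f ∈ L_2(G)`: the limit in `L_2(X)` of
`χ ↦ ∫_{G_{-n}} f(x) conj (χ, x) dμ(x)` as `n → ∞`. -/
def IsFourier (f : ℚ_[p] → ℂ) (F : X p → ℂ) : Prop :=
  MemLp F 2 (ν p) ∧
    Tendsto (fun n : ℕ => eLpNorm
      (fun χ => F χ - ∫ x in G p (-(n : ℤ)), f x * conj (pair χ x) ∂(μ p)) 2 (ν p)) atTop (𝓝 0)

open Classical in
/-- The Fourier transform of `f ∈ L_2(G)`, as a function on `X` that is determined up to
equality almost everywhere. (The value `0` in the second case is never taken when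
`f ∈ L_2(G)`.) -/
def fourier (f : ℚ_[p] → ℂ) : X p → ℂ :=
  if h : ∃ F, IsFourier f F then h.choose else 0

/-- The class `𝔇_{G_M}(G_{-N})` of functions in `L_2(G)` that vanish outside `G_{-N}` and are
constant on the cosets of `G_M`. -/
structure IsStep (M N : ℕ) (φ : ℚ_[p] → ℂ) : Prop where
  memLp : MemLp φ 2 (μ p)
  support : ∀ x, x ∉ G p (-(N : ℤ)) → φ x = 0
  const : ∀ x, ∀ y ∈ G p (M : ℤ), φ (x + y) = φ x

/-- `φ` is refinable: `φ(x) = p ∑_{h ∈ H_0} β_h φ(A x - h)` for some `β ∈ ℓ²(H_0)`. It is used for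
step functions `φ` only; then for every `x` only finitely many terms are nonzero. -/
def IsRefinable (φ : ℚ_[p] → ℂ) : Prop :=
  ∃ β : H0 p → ℂ, Summable (fun h => ‖β h‖ ^ 2) ∧
    ∀ᵐ x ∂(μ p), HasSum (fun h : H0 p => (p : ℂ) * (β h * φ (dil 1 x - (h : ℚ_[p])))) (φ x)

/-- `m` is a mask: `m(χ) = ∑_{h ∈ H_0} β_h conj (χ A⁻¹, h)` for some `β ∈ ℓ²(H_0)`, the series
converging in `L_2(G_k^⊥)` for every `k`. -/
def IsMask (m : X p → ℂ) : Prop :=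
  ∃ β : H0 p → ℂ, Summable (fun h => ‖β h‖ ^ 2) ∧
    ∀ k : ℤ, HasSumL2 (fun (h : H0 p) χ => β h * conj (pair (dilChar (-1) χ) h)) m
      ((ν p).restrict (Gperp p k))

/-- The coset `G_n^⊥ · χ₀`. -/
def coset (n : ℤ) (χ₀ : X p) : Set (X p) := {χ | χ * χ₀⁻¹ ∈ Gperp p n}

/-- The function `ψ_{n,h}(x) = p ^ (n / 2) ψ(A ^ n x - h)`. -/
def wav (ψ : ℚ_[p] → ℂ) (n : ℤ) (h : ℚ_[p]) (x : ℚ_[p]) : ℂ :=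
  (((p : ℝ) ^ ((n : ℝ) / 2) : ℝ) : ℂ) * ψ (dil n x - h)

/-- The inner product `⟨f, g⟩` of `L_2(G)`. -/
def innerL2 (f g : ℚ_[p] → ℂ) : ℂ := ∫ x, f x * conj (g x) ∂(μ p)

end

end PadicFrame

end

noncomputable section

namespace PadicFrame

variable {p : ℕ} [Fact p.Prime]

/-! Everything is read off on the Fourier side. A function whose transform is the indicator of a
coset of `G_{-s}^⊥` must be, almost everywhere, a character restricted to `G_{-s}` and normalised
(`ae_eq_cosetWavelet`). At scale `n` its dilates and translates are multiples of one character cut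
off to cosets of `G_{n-s}`, and the squared coefficients of `f` over all `h ∈ H_0` add up to exactly
the energy of `f̂` on `E_j A^n` (`tsum_enorm_innerL2_wav_cosetWavelet`).

The tiling hypothesis, dilated by all powers of `A`, makes the sets `E_j A^n` pairwise disjoint over
all pairs `(n, j)` (`pairwise_disjoint_image_dilChar`). Hence the wavelets with `n ≤ Ñ` form a
Bessel family with bound 1. For such a family the frame series converges unconditionally, and its
squared distance from `f` is at most the Bessel defect (`exists_hasSum_of_bessel`), which here is
the energy of `f̂` outside the union of the `E_j A^n`. Up to a null set that complement lies in the
annuli `G_{n-l+1}^⊥ \ G_{n-l}^⊥` with `n > Ñ` (`compl_iUnion_image_dilChar_subset`). Subadditivity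
of the square root then gives the estimate with constant 1, and `(N+1) p^{(M-1)/2} ≥ 1`.

The Plancherel theory behind this is derived from orthogonality of characters. On `G_k^⊥` a Fourier
integral is a trigonometric sum whose coefficients are the integrals over cosets of `G_k`
(`setLIntegral_Gperp_FT`); letting `k → ∞` gives Plancherel for compact support (`lintegral_FT_sq`),
and truncation extends it to `L_2`. -/

theorem prime_pos : (0 : ℝ) < p := by exact_mod_cast (Fact.out : p.Prime).pos

theorem one_lt_prime : (1 : ℝ) < p := by exact_mod_cast (Fact.out : p.Prime).one_lt

/-! ### The subgroups `G_n` and the coset representatives `H_0` -/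

theorem mem_G {n : ℤ} {x : ℚ_[p]} : x ∈ G p n ↔ ‖x‖ ≤ (p : ℝ) ^ (-n) := Iff.rfl

theorem G_eq_closedBall (n : ℤ) : G p n = Metric.closedBall 0 ((p : ℝ) ^ (-n)) := by
  ext x; simp [G]

theorem zero_mem_G (n : ℤ) : (0 : ℚ_[p]) ∈ G p n := by
  rw [mem_G, norm_zero]; exact (zpow_pos prime_pos _).le

theorem add_mem_G {n : ℤ} {x y : ℚ_[p]} (hx : x ∈ G p n) (hy : y ∈ G p n) : x + y ∈ G p n :=
  (Padic.nonarchimedean x y).trans (max_le hx hy)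

theorem neg_mem_G {n : ℤ} {x : ℚ_[p]} (hx : x ∈ G p n) : -x ∈ G p n := by
  rwa [mem_G, norm_neg]

theorem sub_mem_G {n : ℤ} {x y : ℚ_[p]} (hx : x ∈ G p n) (hy : y ∈ G p n) : x - y ∈ G p n :=
  sub_eq_add_neg x y ▸ add_mem_G hx (neg_mem_G hy)

theorem add_mem_G_iff {n : ℤ} {x y : ℚ_[p]} (hy : y ∈ G p n) : x + y ∈ G p n ↔ x ∈ G p n :=
  ⟨fun h => by simpa using sub_mem_G h hy, fun h => add_mem_G h hy⟩

theorem G_anti {m n : ℤ} (h : m ≤ n) : G p n ⊆ G p m := fun _ hx =>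
  le_trans hx (zpow_le_zpow_right₀ one_lt_prime.le (by omega))

theorem isOpen_G (n : ℤ) : IsOpen (G p n) := by
  rw [G_eq_closedBall]
  exact IsUltrametricDist.isOpen_closedBall _ (zpow_pos prime_pos _).ne'

theorem isCompact_G (n : ℤ) : IsCompact (G p n) := by
  rw [G_eq_closedBall]; exact isCompact_closedBall _ _

theorem measurableSet_G (n : ℤ) : MeasurableSet (G p n) := (isOpen_G n).measurableSet

theorem exists_mem_G (x : ℚ_[p]) : ∃ n : ℕ, x ∈ G p (-(n : ℤ)) := by
  obtain ⟨n, hn⟩ := pow_unbounded_of_one_lt ‖x‖ (one_lt_prime (p := p))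
  exact ⟨n, by rw [mem_G, neg_neg, zpow_natCast]; exact hn.le⟩

theorem dil_mem_G {k n : ℤ} {x : ℚ_[p]} : dil k x ∈ G p n ↔ x ∈ G p (n + k) := by
  have h : (p : ℝ) ^ k * (p : ℝ) ^ (-(n + k)) = (p : ℝ) ^ (-n) := by
    rw [← zpow_add₀ prime_pos.ne']; congr 1; ring
  rw [mem_G, mem_G, dil, norm_mul, norm_zpow, Padic.norm_p, inv_zpow', neg_neg, ← h,
    mul_le_mul_iff_right₀ (zpow_pos prime_pos _)]

theorem dil_dil (a b : ℤ) (x : ℚ_[p]) : dil a (dil b x) = dil (a + b) x := by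
  have : (p : ℚ_[p]) ≠ 0 := by exact_mod_cast (Fact.out : p.Prime).ne_zero
  rw [dil, dil, dil, ← mul_assoc, ← zpow_add₀ this, neg_add]

theorem dil_zero_left (x : ℚ_[p]) : dil 0 x = x := by simp [dil]

theorem dil_sub (a : ℤ) (x y : ℚ_[p]) : dil a (x - y) = dil a x - dil a y := mul_sub _ _ _

theorem dil_add (a : ℤ) (x y : ℚ_[p]) : dil a (x + y) = dil a x + dil a y := mul_add _ _ _

theorem mem_H0_iff {h : ℚ_[p]} :
    h ∈ H0 p ↔ ∃ s a : ℕ, a < p ^ s ∧ h = (a : ℚ_[p]) * (p : ℚ_[p]) ^ (-(s : ℤ)) := by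
  have hp : (p : ℚ_[p]) ≠ 0 := by exact_mod_cast (Fact.out : p.Prime).ne_zero
  constructor
  · rintro ⟨s, a, ha, rfl⟩
    refine ⟨s, ?_⟩
    induction s with
    | zero => exact ⟨0, by simp⟩
    | succ s ih =>
      obtain ⟨b, hb, hb'⟩ := ih
      refine ⟨b * p + a (s + 1), ?_, ?_⟩
      · rw [pow_succ]; nlinarith [ha (s + 1)]
      · rw [Finset.sum_Icc_succ_top (by omega), hb']
        push_cast
        rw [neg_add, zpow_add₀ hp, zpow_neg_one]
        field_simp
  · rintro ⟨s, a, ha, rfl⟩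
    suffices ∃ d : ℕ → ℕ, (∀ k, d k < p) ∧ (a : ℚ_[p]) * (p : ℚ_[p]) ^ (-(s : ℤ)) =
        ∑ k ∈ Finset.Icc 1 s, (d k : ℚ_[p]) * (p : ℚ_[p]) ^ (-(k : ℤ)) from ⟨s, this⟩
    have p0 := (Fact.out : p.Prime).pos
    induction s generalizing a with
    | zero => exact ⟨fun _ => 0, fun _ => p0, by simp at ha; simp [ha]⟩
    | succ s ih =>
      obtain ⟨d, hd, hd'⟩ := ih (a / p) (Nat.div_lt_of_lt_mul (by rwa [pow_succ'] at ha))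
      refine ⟨Function.update d (s + 1) (a % p), fun k => ?_, ?_⟩
      · by_cases hk : k = s + 1
        · subst hk; simpa using Nat.mod_lt _ p0
        · simpa [hk] using hd k
      · rw [Finset.sum_Icc_succ_top (by omega), Finset.sum_congr rfl (g := fun k : ℕ =>
          (d k : ℚ_[p]) * (p : ℚ_[p]) ^ (-(k : ℤ))), ← hd', Function.update_self]
        · conv_lhs => rw [← Nat.div_add_mod a p]
          push_cast
          rw [neg_add, zpow_add₀ hp, zpow_neg_one]
          field_simp
        · intro k hk
          rw [Finset.mem_Icc] at hk
          rw [Function.update_of_ne (by omega)]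

theorem exists_nat_sub_mem_G {x : ℚ_[p]} (hx : x ∈ G p 0) (s : ℕ) :
    ∃ a : ℕ, a < p ^ s ∧ x - a ∈ G p s := by
  have hx' : ‖x‖ ≤ 1 := by simpa [mem_G] using hx
  obtain ⟨z, rfl⟩ : ∃ z : ℤ_[p], (z : ℚ_[p]) = x := ⟨⟨x, hx'⟩, rfl⟩
  refine ⟨z.appr s, z.appr_lt _, ?_⟩
  have := (PadicInt.norm_le_pow_iff_mem_span_pow _ s).2 (z.appr_spec s)
  rw [mem_G]
  rwa [PadicInt.norm_def, PadicInt.coe_sub, PadicInt.coe_natCast] at this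

theorem nat_eq_of_sub_mem_G {s a b : ℕ} (ha : a < p ^ s) (hb : b < p ^ s)
    (h : (a : ℚ_[p]) - b ∈ G p s) : a = b := by
  have h1 : ‖(((a : ℤ) - b : ℤ) : ℚ_[p])‖ ≤ (p : ℝ) ^ (-(s : ℤ)) := by
    push_cast; exact h
  have h2 := (Padic.norm_int_le_pow_iff_dvd _ _).1 h1
  have h3 : (a : ℤ) - b = 0 := by
    refine Int.eq_zero_of_abs_lt_dvd h2 ?_
    have ha' : (a : ℤ) < (p : ℤ) ^ s := by exact_mod_cast ha
    have hb' : (b : ℤ) < (p : ℤ) ^ s := by exact_mod_cast hb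
    rw [abs_lt]; constructor <;> omega
  omega

theorem mul_zpow_mem_G (k : ℤ) (x : ℚ_[p]) (n : ℤ) :
    x * (p : ℚ_[p]) ^ k ∈ G p n ↔ x ∈ G p (n - k) := by
  have := dil_mem_G (k := -k) (n := n) (x := x)
  rwa [dil, neg_neg, mul_comm] at this

/-- Multiplying by a power `p ^ s` moves `x` into `ℤ_p`, where an integer in `[0, p ^ s)`
approximates it modulo `p ^ s`; dividing back gives the fractional part. -/
theorem exists_H0 (x : ℚ_[p]) : ∃ h : H0 p, x - h ∈ G p 0 := by
  have hp : (p : ℚ_[p]) ≠ 0 := by exact_mod_cast (Fact.out : p.Prime).ne_zero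
  obtain ⟨s, hs⟩ := exists_mem_G x
  obtain ⟨a, ha, ha'⟩ := exists_nat_sub_mem_G (x := x * (p : ℚ_[p]) ^ (s : ℤ))
    ((mul_zpow_mem_G _ _ _).2 (by simpa using hs)) s
  refine ⟨⟨_, mem_H0_iff.2 ⟨s, a, ha, rfl⟩⟩, ?_⟩
  have h1 : x - (a : ℚ_[p]) * (p : ℚ_[p]) ^ (-(s : ℤ)) =
      (x * (p : ℚ_[p]) ^ (s : ℤ) - a) * (p : ℚ_[p]) ^ (-(s : ℤ)) := by
    rw [sub_mul, mul_assoc, ← zpow_add₀ hp]; simp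
  rw [h1, mul_zpow_mem_G]
  simpa using ha'

theorem H0_eq_of_sub_mem {h h' : H0 p} (H : (h : ℚ_[p]) - h' ∈ G p 0) : h = h' := by
  have hp : (p : ℚ_[p]) ≠ 0 := by exact_mod_cast (Fact.out : p.Prime).ne_zero
  obtain ⟨h, hh⟩ := h
  obtain ⟨h', hh'⟩ := h'
  obtain ⟨s, a, ha, rfl⟩ := mem_H0_iff.1 hh
  obtain ⟨t, b, hb, rfl⟩ := mem_H0_iff.1 hh'
  -- Over the common denominator `p ^ (s + t)` both numerators are natural numbers below `p ^ (s +
  -- t)` and congruent modulo it.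
  have e : (a * p ^ t : ℕ) = b * p ^ s := by
    have p0 := (Fact.out : p.Prime).pos
    refine nat_eq_of_sub_mem_G (p := p) (s := s + t) ?_ ?_ ?_
    · rw [pow_add]; gcongr
    · rw [add_comm, pow_add]; gcongr
    · have : ((a * p ^ t : ℕ) : ℚ_[p]) - (b * p ^ s : ℕ) =
        ((a : ℚ_[p]) * (p : ℚ_[p]) ^ (-(s : ℤ)) - (b : ℚ_[p]) * (p : ℚ_[p]) ^ (-(t : ℤ))) *
          (p : ℚ_[p]) ^ ((s + t : ℕ) : ℤ) := by
        push_cast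
        rw [zpow_add₀ hp, zpow_neg, zpow_neg, zpow_natCast, zpow_natCast]
        field_simp
      rw [this, mul_zpow_mem_G]
      simpa using H
  refine Subtype.ext ?_
  have e' : (a : ℚ_[p]) * (p : ℚ_[p]) ^ t = b * (p : ℚ_[p]) ^ s := by exact_mod_cast e
  simp only [zpow_neg, zpow_natCast]
  field_simp
  rw [e', mul_comm]

theorem countable_H0 : (H0 p).Countable := by
  refine (Set.countable_range (fun q : ℚ => (q : ℚ_[p]))).mono fun h hh => ?_
  obtain ⟨s, a, -, rfl⟩ := mem_H0_iff.1 hh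
  exact ⟨(a : ℚ) * (p : ℚ) ^ (-(s : ℤ)), by push_cast; rfl⟩

instance : Countable (H0 p) := countable_H0.to_subtype

/-- The points `p ^ k h`, `h ∈ H_0`, represent the cosets of `G_k`. -/
theorem exists_dil_H0 (k : ℤ) (x : ℚ_[p]) : ∃ h : H0 p, x - dil (-k) h ∈ G p k := by
  obtain ⟨h, hh⟩ := exists_H0 (dil k x)
  refine ⟨h, ?_⟩
  rw [← zero_add k, ← dil_mem_G, dil_sub, dil_dil]
  simpa [dil_zero_left] using hh

theorem dil_H0_eq_of_sub_mem {k : ℤ} {h h' : H0 p}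
    (H : dil (-k) (h : ℚ_[p]) - dil (-k) h' ∈ G p k) : h = h' := by
  refine H0_eq_of_sub_mem ?_
  rw [← dil_sub, dil_mem_G] at H
  simpa using H

/-! ### The Haar measure -/

theorem addHaar_G_ne_zero (n : ℤ) : (Measure.addHaar : Measure ℚ_[p]) (G p n) ≠ 0 :=
  ((isOpen_G n).measure_pos _ ⟨0, zero_mem_G n⟩).ne'

theorem addHaar_G_ne_top (n : ℤ) : (Measure.addHaar : Measure ℚ_[p]) (G p n) ≠ ∞ :=
  (isCompact_G n).measure_lt_top.ne

instance : (μ p).IsAddHaarMeasure :=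
  Measure.IsAddHaarMeasure.smul _ (ENNReal.inv_ne_zero.2 (addHaar_G_ne_top 0))
    (ENNReal.inv_ne_top.2 (addHaar_G_ne_zero 0))

theorem μ_G_zero : μ p (G p 0) = 1 := by
  rw [μ, Measure.smul_apply, smul_eq_mul]
  exact ENNReal.inv_mul_cancel (addHaar_G_ne_zero 0) (addHaar_G_ne_top 0)

/-- The coset `x + G_k`. -/
def cell (k : ℤ) (x : ℚ_[p]) : Set ℚ_[p] := {y | y - x ∈ G p k}

theorem measure_cell (k : ℤ) (x : ℚ_[p]) : μ p (cell k x) = μ p (G p k) := by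
  have := measure_preimage_add_right (μ p) (-x) (G p k)
  simpa [cell, Set.preimage, ← sub_eq_add_neg] using this

theorem measurableSet_cell (k : ℤ) (x : ℚ_[p]) : MeasurableSet (cell k x) :=
  (measurable_id.sub_const x) (measurableSet_G k)

theorem μ_G_succ (n : ℤ) : μ p (G p n) = p * μ p (G p (n + 1)) := by
  have hp : (p : ℚ_[p]) ≠ 0 := by exact_mod_cast (Fact.out : p.Prime).ne_zero
  -- The cosets of `G_{n+1}` in `G_n` are indexed by the digit at `p ^ n`.
  have key : G p n = ⋃ a : Fin p, cell (n + 1) (dil (-n) (a : ℕ)) := by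
    ext y
    simp only [Set.mem_iUnion, cell, Set.mem_ofPred_eq]
    constructor
    · intro hy
      obtain ⟨a, ha, ha'⟩ := exists_nat_sub_mem_G (x := dil n y) (dil_mem_G.2 (by simpa)) 1
      refine ⟨⟨a, by simpa using ha⟩, ?_⟩
      rw [add_comm, ← dil_mem_G, dil_sub, dil_dil]
      simpa [dil_zero_left] using ha'
    · rintro ⟨a, ha⟩
      have h1 : dil (-n) (((a : ℕ) : ℚ_[p])) ∈ G p n := by
        rw [dil_mem_G, mem_G]; simpa using Padic.norm_int_le_one (p := p) (a : ℕ)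
      simpa using add_mem_G (G_anti (by omega) ha) h1
  rw [key, measure_iUnion]
  · simp [measure_cell]
  · intro a b hab
    refine Set.disjoint_left.2 fun y hy hy' => hab ?_
    have h1 := sub_mem_G hy' hy
    rw [sub_sub_sub_cancel_left, ← dil_sub, dil_mem_G] at h1
    exact Fin.ext (nat_eq_of_sub_mem_G (p := p) (s := 1) (by simp) (by simp) (by simpa using h1))
  · exact fun a => measurableSet_cell _ _

theorem μ_G (n : ℤ) : μ p (G p n) = (p : ℝ≥0∞) ^ (-n) := by
  have hp : (p : ℝ≥0∞) ≠ 0 := by exact_mod_cast (Fact.out : p.Prime).ne_zero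
  have hp' : (p : ℝ≥0∞) ≠ ∞ := ENNReal.natCast_ne_top p
  induction n using Int.induction_on with
  | zero => simpa using μ_G_zero
  | succ n ih =>
    rw [μ_G_succ] at ih
    rw [neg_add, ENNReal.zpow_add hp hp', ← ih, mul_comm, ← mul_assoc, zpow_neg_one,
      ENNReal.inv_mul_cancel hp hp', one_mul]
  | pred n ih =>
    rw [μ_G_succ, sub_add_cancel, ih, neg_sub, sub_eq_add_neg, ENNReal.zpow_add hp hp', zpow_one]

theorem μ_G_ne_zero (n : ℤ) : μ p (G p n) ≠ 0 :=
  ((isOpen_G n).measure_pos _ ⟨0, zero_mem_G n⟩).ne'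

theorem μ_G_ne_top (n : ℤ) : μ p (G p n) ≠ ∞ := (isCompact_G n).measure_lt_top.ne

theorem iUnion_cell (k : ℤ) : ⋃ h : H0 p, cell k (dil (-k) (h : ℚ_[p])) = Set.univ :=
  Set.eq_univ_of_forall fun x => Set.mem_iUnion.2 (exists_dil_H0 k x)

theorem pairwise_disjoint_cell (k : ℤ) :
    Pairwise (Function.onFun Disjoint fun h : H0 p => cell k (dil (-k) (h : ℚ_[p]))) := by
  intro a b hab
  refine Set.disjoint_left.2 fun y hy hy' => hab (dil_H0_eq_of_sub_mem (k := k) ?_)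
  simpa using sub_mem_G hy' hy

theorem lintegral_eq_tsum (k : ℤ) (w : ℚ_[p] → ℝ≥0∞) :
    ∫⁻ x, w x ∂(μ p) = ∑' h : H0 p, ∫⁻ x in cell k (dil (-k) h), w x ∂(μ p) := by
  rw [← setLIntegral_univ, ← iUnion_cell k, lintegral_iUnion (fun h => measurableSet_cell _ _)
    (pairwise_disjoint_cell k)]

theorem lintegral_eq_tsum_of_invariant (k : ℤ) (w : ℚ_[p] → ℝ≥0∞)
    (hw : ∀ x, ∀ y ∈ G p k, w (x + y) = w x) :
    ∫⁻ x, w x ∂(μ p) = μ p (G p k) * ∑' h : H0 p, w (dil (-k) h) := by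
  rw [lintegral_eq_tsum k, ← ENNReal.tsum_mul_left]
  congr 1; ext h
  rw [setLIntegral_congr_fun (g := fun _ => w (dil (-k) h)) (measurableSet_cell _ _)]
  · simp [measure_cell, mul_comm]
  · intro x hx
    have := hw (dil (-k) h) _ hx
    simpa using this

/-- Needed for the Lebesgue differentiation theorem. If `p ^ n ≤ ε < p ^ (n+1)`, then `2ε ≤ p ^
(n+2)` because `2 ≤ p`, whence the doubling constant `p ^ 2`. -/
instance : IsUnifLocDoublingMeasure (μ p) := by
  refine ⟨⟨(p : NNReal) ^ 2, ?_⟩⟩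
  filter_upwards [self_mem_nhdsWithin] with ε hε x
  obtain ⟨n, hn1, hn2⟩ := exists_mem_Ico_zpow (Set.mem_Ioi.1 hε) (one_lt_prime (p := p))
  have hb : ∀ n : ℤ, μ p (Metric.closedBall x ((p : ℝ) ^ n)) = (p : ℝ≥0∞) ^ n := fun n => by
    rw [← neg_neg n, ← μ_G, ← measure_cell _ x]
    simp [cell, Metric.closedBall, mem_G, dist_eq_norm]
  have h2 : (2 : ℝ) ≤ p := by exact_mod_cast (Fact.out : p.Prime).two_le
  calc μ p (Metric.closedBall x (2 * ε))
      ≤ μ p (Metric.closedBall x ((p : ℝ) ^ (2 + n))) := by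
        refine measure_mono (Metric.closedBall_subset_closedBall ?_)
        rw [show 2 + n = 1 + (n + 1) by ring, zpow_add₀ prime_pos.ne', zpow_one]
        exact mul_le_mul h2 hn2.le (le_of_lt hε) prime_pos.le
    _ = (p : NNReal) ^ 2 * μ p (Metric.closedBall x ((p : ℝ) ^ n)) := by
        rw [hb, hb, ENNReal.zpow_add (by exact_mod_cast (Fact.out : p.Prime).ne_zero)
          (ENNReal.natCast_ne_top p), zpow_ofNat, ENNReal.coe_natCast]
    _ ≤ _ := by rw [ENNReal.coe_pow]; gcongr

/-! ### Characters and the annihilators `G_n^⊥` -/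

theorem pair_add (χ : X p) (x y : ℚ_[p]) : pair χ (x + y) = pair χ x * pair χ y := by
  simp [pair, ofAdd_add, map_mul]

theorem pair_zero (χ : X p) : pair χ 0 = 1 := by simp [pair]

theorem pair_mul (χ χ' : X p) (x : ℚ_[p]) : pair (χ * χ') x = pair χ x * pair χ' x := rfl

theorem pair_one (x : ℚ_[p]) : pair (1 : X p) x = 1 := rfl

theorem norm_pair (χ : X p) (x : ℚ_[p]) : ‖pair χ x‖ = 1 := Circle.norm_coe _

theorem pair_mul_conj (χ : X p) (x : ℚ_[p]) : pair χ x * conj (pair χ x) = 1 := by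
  rw [Complex.mul_conj, Complex.normSq_eq_norm_sq, norm_pair]; simp

theorem pair_neg (χ : X p) (x : ℚ_[p]) : pair χ (-x) = conj (pair χ x) := by
  have h : pair χ x * pair χ (-x) = 1 := by rw [← pair_add, add_neg_cancel, pair_zero]
  rw [← one_mul (pair χ (-x)), ← pair_mul_conj χ x, mul_right_comm, h, one_mul]

theorem pair_inv (χ : X p) (x : ℚ_[p]) : pair χ⁻¹ x = conj (pair χ x) := by
  have h : pair χ x * pair χ⁻¹ x = 1 := by rw [← pair_mul, mul_inv_cancel, pair_one]
  rw [← one_mul (pair χ⁻¹ x), ← pair_mul_conj χ x, mul_right_comm, h, one_mul]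

theorem continuous_pair (χ : X p) : Continuous (pair χ) :=
  continuous_subtype_val.comp ((map_continuous χ).comp continuous_ofAdd)

theorem continuous_pair_left (x : ℚ_[p]) : Continuous fun χ : X p => pair χ x := by
  have h : Continuous fun χ : Multiplicative ℚ_[p] →ₜ* Circle => χ (Multiplicative.ofAdd x) :=
    (continuous_eval_const (F := C(Multiplicative ℚ_[p], Circle)) (Multiplicative.ofAdd x)).comp
      (ContinuousMonoidHom.isInducing_toContinuousMap _ _).continuous
  exact continuous_subtype_val.comp h

theorem X_ext {χ χ' : X p} (h : ∀ x, pair χ x = pair χ' x) : χ = χ' :=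
  PontryaginDual.ext fun a => Circle.ext (h a.toAdd)

theorem one_mem_Gperp (n : ℤ) : (1 : X p) ∈ Gperp p n := fun _ _ => rfl

theorem mul_mem_Gperp {n : ℤ} {χ χ' : X p} (h : χ ∈ Gperp p n) (h' : χ' ∈ Gperp p n) :
    χ * χ' ∈ Gperp p n := fun x hx => by rw [pair_mul, h x hx, h' x hx, one_mul]

theorem inv_mem_Gperp {n : ℤ} {χ : X p} (h : χ ∈ Gperp p n) : χ⁻¹ ∈ Gperp p n := fun x hx => by
  rw [pair_inv, h x hx, map_one]

theorem mul_mem_Gperp_iff {n : ℤ} {χ χ' : X p} (h : χ ∈ Gperp p n) :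
    χ * χ' ∈ Gperp p n ↔ χ' ∈ Gperp p n :=
  ⟨fun h' => by simpa using mul_mem_Gperp (inv_mem_Gperp h) h', mul_mem_Gperp h⟩

theorem Gperp_mono {m n : ℤ} (h : m ≤ n) : Gperp p m ⊆ Gperp p n :=
  fun _ hχ x hx => hχ x (G_anti h hx)

theorem pair_add_of_mem {n : ℤ} {χ : X p} (hχ : χ ∈ Gperp p n) (x : ℚ_[p]) {y : ℚ_[p]}
    (hy : y ∈ G p n) : pair χ (x + y) = pair χ x := by rw [pair_add, hχ y hy, mul_one]

/-- The circle has no small subgroups: if all powers of a point stay in the arc of half-width `π /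
2` around 1, the point is 1. As `G_n` is compact and the arc open, this exhibits the annihilator as
open in the compact-open topology. -/
theorem mem_Gperp_iff_mapsTo {n : ℤ} {χ : X p} :
    χ ∈ Gperp p n ↔
      Set.MapsTo χ (Multiplicative.ofAdd '' G p n) (Circle.centeredArc (Real.pi / 2)) := by
  constructor
  · rintro h _ ⟨x, hx, rfl⟩
    have : χ (Multiplicative.ofAdd x) = 1 := Circle.ext (h x hx)
    rw [this, Circle.mem_centeredArc (by linarith [Real.pi_pos])]
    simp [Real.pi_pos]
  · intro h x hx
    have : χ (Multiplicative.ofAdd x) = 1 := by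
      refine Circle.eq_one_of_forall_pow_mem_centeredArc_pi_div_two fun k _ => ?_
      rw [← map_pow]
      refine h ⟨k • x, ?_, rfl⟩
      rw [mem_G, nsmul_eq_mul, norm_mul]
      refine (mul_le_of_le_one_left (norm_nonneg _) ?_).trans hx
      simpa using Padic.norm_int_le_one (p := p) (k : ℤ)
    rw [pair, this]; rfl

theorem isOpen_Gperp (n : ℤ) : IsOpen (Gperp p n) := by
  have h : Gperp p n = {χ : X p | Set.MapsTo χ (Multiplicative.ofAdd '' G p n)
      (Circle.centeredArc (Real.pi / 2))} := Set.ext fun χ => mem_Gperp_iff_mapsTo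
  rw [h]
  exact isOpen_induced (ContinuousMap.isOpen_setOfPred_mapsTo
    ((isCompact_G n).image continuous_ofAdd) (Circle.isOpen_centeredArc (Real.pi / 2)))

theorem isClosed_Gperp (n : ℤ) : IsClosed (Gperp p n) := by
  have h : Gperp p n = ⋂ x ∈ G p n, {χ | pair χ x = 1} := by ext; simp [Gperp]
  rw [h]
  exact isClosed_biInter fun x _ => isClosed_singleton.preimage (continuous_pair_left x)

theorem measurableSet_Gperp (n : ℤ) : MeasurableSet (Gperp p n) := (isOpen_Gperp n).measurableSet

theorem exists_mem_Gperp (χ : X p) : ∃ n : ℕ, χ ∈ Gperp p n := by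
  have h1 : (fun x : ℚ_[p] => χ (Multiplicative.ofAdd x)) ⁻¹' (Circle.centeredArc (Real.pi / 2))
      ∈ 𝓝 (0 : ℚ_[p]) := by
    refine ((map_continuous χ).comp continuous_ofAdd).continuousAt.preimage_mem_nhds ?_
    refine (Circle.isOpen_centeredArc _).mem_nhds ?_
    have : (χ ∘ Multiplicative.ofAdd) (0 : ℚ_[p]) = 1 := by simp
    rw [this, Circle.mem_centeredArc (by linarith [Real.pi_pos])]
    simp [Real.pi_pos]
  obtain ⟨ε, hε, hε'⟩ := Metric.mem_nhds_iff.1 h1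
  obtain ⟨n, hn⟩ := exists_pow_lt_of_lt_one hε
    (inv_lt_one_of_one_lt₀ (one_lt_prime (p := p)))
  refine ⟨n, mem_Gperp_iff_mapsTo.2 ?_⟩
  rintro _ ⟨x, hx, rfl⟩
  refine hε' ?_
  rw [mem_ball_zero_iff]
  refine lt_of_le_of_lt hx ?_
  simpa using hn

/-! ### Dilations -/

theorem dilChar_dilChar (a b : ℤ) (χ : X p) : dilChar a (dilChar b χ) = dilChar (a + b) χ :=
  X_ext fun x => by simp only [pair_dilChar, dil_dil]; rw [add_comm]

theorem dilChar_zero (χ : X p) : dilChar 0 χ = χ :=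
  X_ext fun x => by rw [pair_dilChar, dil_zero_left]

theorem dilChar_mul (a : ℤ) (χ χ' : X p) : dilChar a (χ * χ') = dilChar a χ * dilChar a χ' := rfl

theorem dilChar_inv (a : ℤ) (χ : X p) : dilChar a χ⁻¹ = (dilChar a χ)⁻¹ :=
  map_inv (PontryaginDual.map (dilHom p a)) χ

theorem continuous_dilChar (a : ℤ) : Continuous (dilChar a : X p → X p) :=
  map_continuous (PontryaginDual.map (dilHom p a))

theorem dilChar_mem_Gperp {k n : ℤ} {χ : X p} : dilChar k χ ∈ Gperp p (n + k) ↔ χ ∈ Gperp p n := by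
  constructor
  · intro h x hx
    have := h (dil (-k) x) (by rw [dil_mem_G]; simpa using hx)
    rwa [pair_dilChar, dil_dil, add_neg_cancel, dil_zero_left] at this
  · intro h x hx
    rw [pair_dilChar]
    exact h _ (dil_mem_G.2 hx)

theorem mem_image_dilChar {k : ℤ} {S : Set (X p)} {χ : X p} :
    χ ∈ dilChar k '' S ↔ dilChar (-k) χ ∈ S := by
  constructor
  · rintro ⟨χ, h, rfl⟩; simpa [dilChar_dilChar, dilChar_zero] using h
  · intro h; exact ⟨_, h, by simp [dilChar_dilChar, dilChar_zero]⟩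

theorem image_dilChar_Gperp (k n : ℤ) : dilChar k '' Gperp p n = Gperp p (n + k) := by
  ext χ
  rw [mem_image_dilChar, ← dilChar_mem_Gperp (k := k), dilChar_dilChar, add_neg_cancel,
    dilChar_zero]

theorem image_dilChar_coset (k n : ℤ) (η : X p) :
    dilChar k '' coset n η = coset (n + k) (dilChar k η) := by
  ext χ
  rw [mem_image_dilChar, coset, coset, Set.mem_ofPred_eq, Set.mem_ofPred_eq,
    ← dilChar_mem_Gperp (k := k), dilChar_mul, dilChar_dilChar, add_neg_cancel, dilChar_zero,
    dilChar_inv]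

/-- Any compact set of points lies in some `G_{-n}`, where the characters of `G_{-n}^⊥` are
identically 1; so these annihilators shrink to the trivial character. -/
theorem exists_Gperp_subset {K : Set (X p)} (hK : K ∈ 𝓝 (1 : X p)) : ∃ n : ℤ, Gperp p n ⊆ K := by
  by_contra! H
  have H' : ∀ n : ℕ, ∃ χ ∈ Gperp p (-(n : ℤ)), χ ∉ K := fun n => by
    simpa [Set.not_subset] using H (-(n : ℤ))
  choose χ hχ hχK using H'
  have hlim : Tendsto χ atTop (𝓝 1) := by
    refine (ContinuousMonoidHom.isInducing_toContinuousMap (Multiplicative ℚ_[p])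
      Circle).tendsto_nhds_iff.2 ?_
    rw [ContinuousMap.tendsto_nhds_compactOpen]
    intro C hC U _ hU
    obtain ⟨r, hr⟩ := ((hC.image continuous_toAdd).isBounded.subset_closedBall (0 : ℚ_[p]))
    obtain ⟨n, hn⟩ := pow_unbounded_of_one_lt r (one_lt_prime (p := p))
    filter_upwards [eventually_ge_atTop n] with m hm x hx
    have h1 : x.toAdd ∈ G p (-(m : ℤ)) := by
      have := hr ⟨x, hx, rfl⟩
      rw [mem_closedBall_zero_iff] at this
      refine G_anti (n := -(n : ℤ)) (by omega) ?_
      rw [mem_G, neg_neg, zpow_natCast]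
      exact this.trans hn.le
    have h2 : χ m x = 1 := Circle.ext (hχ m _ h1)
    have h3 := hU hx
    change χ m x ∈ U
    rw [h2]; exact h3
  obtain ⟨n, hn⟩ := (hlim.eventually hK).exists
  exact hχK n hn

theorem isCompact_Gperp (n : ℤ) : IsCompact (Gperp p n) := by
  -- Local compactness of `X` makes one annihilator compact; dilations carry it to all the others.
  obtain ⟨K, hK, hK1⟩ := exists_compact_mem_nhds (1 : X p)
  obtain ⟨m, hm⟩ := exists_Gperp_subset hK1
  have h := (hK.of_isClosed_subset (isClosed_Gperp m) hm).image (continuous_dilChar (n - m))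
  rwa [image_dilChar_Gperp, add_sub_cancel] at h

/-! ### The Haar measure of the dual -/

theorem haar_Gperp_ne_zero (n : ℤ) : (Measure.haar : Measure (X p)) (Gperp p n) ≠ 0 :=
  ((isOpen_Gperp n).measure_pos _ ⟨1, one_mem_Gperp n⟩).ne'

theorem haar_Gperp_ne_top (n : ℤ) : (Measure.haar : Measure (X p)) (Gperp p n) ≠ ∞ :=
  (isCompact_Gperp n).measure_lt_top.ne

instance : (ν p).IsHaarMeasure :=
  Measure.IsHaarMeasure.smul _ (ENNReal.inv_ne_zero.2 (haar_Gperp_ne_top 0))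
    (ENNReal.inv_ne_top.2 (haar_Gperp_ne_zero 0))

theorem ν_Gperp_zero : ν p (Gperp p 0) = 1 := by
  rw [ν, Measure.smul_apply, smul_eq_mul]
  exact ENNReal.inv_mul_cancel (haar_Gperp_ne_zero 0) (haar_Gperp_ne_top 0)

theorem ν_Gperp_ne_top (n : ℤ) : ν p (Gperp p n) ≠ ∞ := (isCompact_Gperp n).measure_lt_top.ne

theorem measurableSet_coset (n : ℤ) (η : X p) : MeasurableSet (coset n η) :=
  ((isOpen_Gperp n).preimage (continuous_mul_const η⁻¹)).measurableSet

theorem setLIntegral_coset (n : ℤ) (η : X p) (w : X p → ℝ≥0∞) :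
    ∫⁻ χ in coset n η, w χ ∂(ν p) = ∫⁻ χ in Gperp p n, w (χ * η) ∂(ν p) := by
  rw [← (measurePreserving_mul_right (ν p) η).setLIntegral_comp_preimage_emb
    (MeasurableEquiv.mulRight η).measurableEmbedding]
  congr 2
  ext χ; simp [coset]

/-! ### Orthogonality relations -/

variable (p) in
/-- `G_n` as an additive subgroup. -/
def GSubgroup (n : ℤ) : AddSubgroup ℚ_[p] where
  carrier := G p n
  zero_mem' := zero_mem_G n
  add_mem' := add_mem_G
  neg_mem' := neg_mem_G

/-- The embedding of `ℚ / ℤ` into the circle. -/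
def ratCircle : AddCircle (1 : ℚ) →+ Additive Circle :=
  QuotientAddGroup.lift _
    { toFun := fun q => Additive.ofMul (Circle.exp (2 * Real.pi * (q : ℝ)))
      map_zero' := by simp
      map_add' := fun a b => by
        rw [← ofMul_mul, ← Circle.exp_add]; congr 2; push_cast; ring }
    (by
      rintro x ⟨n, rfl⟩
      refine congrArg Additive.ofMul (Circle.exp_eq_one.2 ⟨n, ?_⟩)
      push_cast [zsmul_eq_mul]; ring)

theorem ratCircle_injective : Function.Injective ratCircle := by
  rw [injective_iff_map_eq_zero]
  intro a ha
  obtain ⟨q, rfl⟩ := QuotientAddGroup.mk_surjective a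
  have h : Circle.exp (2 * Real.pi * (q : ℝ)) = 1 := congrArg Additive.toMul ha
  obtain ⟨n, hn⟩ := Circle.exp_eq_one.1 h
  refine (QuotientAddGroup.eq_zero_iff q).2 ⟨n, ?_⟩
  have h2 : (q : ℝ) = n := by
    have := Real.pi_pos
    have h3 : (2 * Real.pi) * (q : ℝ) = (2 * Real.pi) * n := by rw [hn]; ring
    exact mul_left_cancel₀ (by positivity) h3
  simp only [zsmul_eq_mul, mul_one]
  exact_mod_cast h2.symm

/-- Characters vanishing on `G_n` separate the points outside `G_n` from `0`. -/
theorem exists_pair_ne_one {n : ℤ} {z : ℚ_[p]} (hz : z ∉ G p n) :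
    ∃ χ ∈ Gperp p n, pair χ z ≠ 1 := by
  have hz' : (QuotientAddGroup.mk z : ℚ_[p] ⧸ GSubgroup p n) ≠ 0 := fun h =>
    hz ((QuotientAddGroup.eq_zero_iff z).1 h)
  -- `ℚ / ℤ`-valued characters separate the points of the abstract quotient by `G_n`. The lift to
  -- `ℚ_p` is trivial on the open subgroup `G_n`, so its continuity is automatic.
  obtain ⟨c, hc⟩ := CharacterModule.exists_character_apply_ne_zero_of_ne_zero hz'
  let φ : ℚ_[p] →+ Additive Circle :=
    (ratCircle.comp (c : ℚ_[p] ⧸ GSubgroup p n →+ AddCircle (1 : ℚ))).comp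
      (QuotientAddGroup.mk' (GSubgroup p n))
  have hφ : ∀ x ∈ G p n, φ x = 0 := fun x hx => by
    have : (QuotientAddGroup.mk' (GSubgroup p n)) x = 0 := (QuotientAddGroup.eq_zero_iff x).2 hx
    simp only [φ, AddMonoidHom.comp_apply, this, map_zero]
  let χ : Multiplicative ℚ_[p] →ₜ* Circle :=
    { toMonoidHom := AddMonoidHom.toMultiplicativeLeft φ
      continuous_toFun := by
        refine continuous_of_continuousAt_one (AddMonoidHom.toMultiplicativeLeft φ) ?_
        refine (continuousAt_const (y := (1 : Circle))).congr ?_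
        filter_upwards [((isOpen_G n).preimage continuous_toAdd).mem_nhds
          (show (1 : Multiplicative ℚ_[p]) ∈ _ from zero_mem_G n)] with x hx
        exact (congrArg Additive.toMul (hφ _ hx)).symm }
  refine ⟨χ, fun x hx => ?_, fun h => hc ?_⟩
  · exact congrArg (fun u : Additive Circle => ((Additive.toMul u : Circle) : ℂ)) (hφ x hx)
  · refine ratCircle_injective ?_
    rw [map_zero]
    have h1 : Additive.toMul (φ z) = 1 := Circle.ext h
    exact h1

theorem setIntegral_Gperp_pair (k : ℤ) (z : ℚ_[p]) [Decidable (z ∈ G p k)] :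
    ∫ χ in Gperp p k, pair χ z ∂(ν p) = if z ∈ G p k then ((ν p).real (Gperp p k) : ℂ) else 0 := by
  split_ifs with hz
  · rw [setIntegral_congr_fun (g := fun _ => (1 : ℂ)) (measurableSet_Gperp k)
      (fun χ hχ => hχ z hz)]
    simp
  · obtain ⟨χ₀, hχ₀, h⟩ := exists_pair_ne_one hz
    -- Translating by `χ₀` preserves the domain and multiplies the integral by a factor different
    -- from 1, so the integral vanishes.
    have h1 : ∫ χ in Gperp p k, pair χ z ∂(ν p) = pair χ₀ z * ∫ χ in Gperp p k, pair χ z ∂(ν p) := by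
      rw [← integral_const_mul, ← integral_indicator (measurableSet_Gperp k),
        ← integral_indicator (measurableSet_Gperp k),
        ← integral_mul_left_eq_self ((Gperp p k).indicator fun χ => pair χ z) χ₀]
      congr 1; ext χ
      by_cases hχ : χ ∈ Gperp p k
      · simp [Set.indicator_of_mem, hχ, (mul_mem_Gperp_iff hχ₀).2 hχ, pair_mul]
      · simp [Set.indicator_of_notMem, hχ, mt (mul_mem_Gperp_iff hχ₀).1 hχ]
    have h2 : (1 - pair χ₀ z) * ∫ χ in Gperp p k, pair χ z ∂(ν p) = 0 := by
      rw [sub_mul, one_mul, ← h1, sub_self]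
    exact (mul_eq_zero.1 h2).resolve_left (sub_ne_zero.2 (Ne.symm h))

theorem setIntegral_G_conj_pair (m : ℤ) (χ : X p) [Decidable (χ ∈ Gperp p m)] :
    ∫ x in G p m, conj (pair χ x) ∂(μ p) =
      if χ ∈ Gperp p m then ((μ p).real (G p m) : ℂ) else 0 := by
  split_ifs with hχ
  · rw [setIntegral_congr_fun (g := fun _ => (1 : ℂ)) (measurableSet_G m)
      (fun x hx => by simp [hχ x hx])]
    simp
  · obtain ⟨x₀, hx₀, h⟩ : ∃ x₀ ∈ G p m, conj (pair χ x₀) ≠ 1 := by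
      by_contra! H
      exact hχ fun x hx => by simpa using congrArg conj (H x hx)
    have h1 : ∫ x in G p m, conj (pair χ x) ∂(μ p) =
        conj (pair χ x₀) * ∫ x in G p m, conj (pair χ x) ∂(μ p) := by
      rw [← integral_const_mul, ← integral_indicator (measurableSet_G m),
        ← integral_indicator (measurableSet_G m),
        ← integral_add_right_eq_self ((G p m).indicator fun x => conj (pair χ x)) x₀]
      congr 1; ext x
      by_cases hx : x ∈ G p m
      · simp [Set.indicator_of_mem, hx, (add_mem_G_iff hx₀).2 hx, pair_add, mul_comm]
      · simp [Set.indicator_of_notMem, hx, mt (add_mem_G_iff hx₀).1 hx]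
    have h2 : (1 - conj (pair χ x₀)) * ∫ x in G p m, conj (pair χ x) ∂(μ p) = 0 := by
      rw [sub_mul, one_mul, ← h1, sub_self]
    exact (mul_eq_zero.1 h2).resolve_left (sub_ne_zero.2 (Ne.symm h))

/-! ### Energy identities and Plancherel for functions of compact support -/

theorem eLpNorm_two_eq {α : Type*} [MeasurableSpace α] (f : α → ℂ) (m : Measure α) :
    eLpNorm f 2 m = (∫⁻ x, ‖f x‖ₑ ^ 2 ∂m) ^ (1 / 2 : ℝ) := by
  rw [eLpNorm_eq_lintegral_rpow_enorm_toReal two_ne_zero ENNReal.ofNat_ne_top]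
  simp

theorem eLpNorm_two_sq {α : Type*} [MeasurableSpace α] (f : α → ℂ) (m : Measure α) :
    eLpNorm f 2 m ^ 2 = ∫⁻ x, ‖f x‖ₑ ^ 2 ∂m := by
  rw [eLpNorm_two_eq, ← ENNReal.rpow_natCast, ← ENNReal.rpow_mul]
  simp

/-- The Cauchy–Schwarz inequality on a set. -/
theorem enorm_setIntegral_sq_le {α : Type*} [MeasurableSpace α] {m : Measure α} {f : α → ℂ}
    (hf : AEStronglyMeasurable f m) (s : Set α) :
    ‖∫ x in s, f x ∂m‖ₑ ^ 2 ≤ m s * ∫⁻ x in s, ‖f x‖ₑ ^ 2 ∂m := by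
  have h := eLpNorm_le_eLpNorm_mul_rpow_measure_univ (μ := m.restrict s) (p := 1) (q := 2)
    (by norm_num) hf.restrict
  rw [eLpNorm_one_eq_lintegral_enorm] at h
  have h2 := pow_le_pow_left' ((enorm_integral_le_lintegral_enorm _).trans h) 2
  refine h2.trans (le_of_eq ?_)
  rw [mul_pow, eLpNorm_two_sq, mul_comm, Measure.restrict_apply_univ, ← ENNReal.rpow_natCast,
    ← ENNReal.rpow_mul]
  norm_num

/-- The Fourier integral of an integrable function. -/
def FT (g : ℚ_[p] → ℂ) (χ : X p) : ℂ := ∫ x, g x * conj (pair χ x) ∂(μ p)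

theorem continuous_conj_pair (χ : X p) : Continuous fun x => conj (pair χ x) :=
  Complex.continuous_conj.comp (continuous_pair χ)

theorem integrable_mul_conj_pair {g : ℚ_[p] → ℂ} {m : Measure ℚ_[p]} (hg : Integrable g m)
    (χ : X p) : Integrable (fun x => g x * conj (pair χ x)) m := by
  refine hg.mul_bdd (c := 1) (continuous_conj_pair χ).aestronglyMeasurable (ae_of_all _ fun x => ?_)
  simp [norm_pair]

theorem continuous_of_add_invariant {β : Type*} [TopologicalSpace β] {k : ℤ} {w : ℚ_[p] → β}
    (hw : ∀ x, ∀ y ∈ G p k, w (x + y) = w x) : Continuous w := by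
  refine IsLocallyConstant.continuous ((IsLocallyConstant.iff_eventually_eq _).2 fun x => ?_)
  have h : {y | y - x ∈ G p k} ∈ 𝓝 x :=
    ((isOpen_G k).preimage (continuous_id.sub continuous_const)).mem_nhds
      (by simpa using zero_mem_G k)
  filter_upwards [h] with y hy
  simpa using hw x _ hy

theorem continuous_of_mul_invariant {β : Type*} [TopologicalSpace β] {k : ℤ} {w : X p → β}
    (hw : ∀ χ, ∀ θ ∈ Gperp p k, w (χ * θ) = w χ) : Continuous w := by
  refine IsLocallyConstant.continuous ((IsLocallyConstant.iff_eventually_eq _).2 fun χ => ?_)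
  have h : {χ' | χ⁻¹ * χ' ∈ Gperp p k} ∈ 𝓝 χ :=
    ((isOpen_Gperp k).preimage (continuous_const_mul χ⁻¹)).mem_nhds
      (by simpa using one_mem_Gperp k)
  filter_upwards [h] with χ' hy
  simpa using hw χ _ hy

theorem continuous_FT {g : ℚ_[p] → ℂ} {m : ℤ} (hs : ∀ x ∉ G p m, g x = 0) :
    Continuous (FT g) := by
  refine continuous_of_mul_invariant (k := m) fun χ θ hθ => integral_congr_ae (ae_of_all _ ?_)
  intro x
  by_cases hx : x ∈ G p m
  · simp [pair_mul, hθ x hx]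
  · simp [hs x hx]

theorem setLIntegral_Gperp_sum {k : ℤ} (T : Finset (H0 p)) (a : H0 p → ℂ) :
    ∫⁻ χ in Gperp p k, ‖∑ h ∈ T, conj (pair χ (dil (-k) h)) * a h‖ₑ ^ 2 ∂(ν p) =
      ν p (Gperp p k) * ∑ h ∈ T, ‖a h‖ₑ ^ 2 := by
  classical
  have hfin : IsFiniteMeasure ((ν p).restrict (Gperp p k)) :=
    isFiniteMeasure_restrict.2 (ν_Gperp_ne_top k)
  have hpair : ∀ z : ℚ_[p], Integrable (fun χ => pair χ z) ((ν p).restrict (Gperp p k)) :=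
    fun z => .of_bound (continuous_pair_left z).aestronglyMeasurable 1
      (ae_of_all _ fun χ => (norm_pair χ z).le)
  let u : X p → ℂ := fun χ => ∑ h ∈ T, conj (pair χ (dil (-k) h)) * a h
  -- Expanding the square leaves pairings at differences of representatives; by orthogonality only
  -- the diagonal survives integration over `G_k^⊥`.
  have hexp : ∀ χ, ((‖u χ‖ ^ 2 : ℝ) : ℂ) = ∑ h ∈ T, ∑ h' ∈ T,
      pair χ (dil (-k) h' - dil (-k) h) * (a h * conj (a h')) := fun χ => by
    rw [← Complex.normSq_eq_norm_sq, ← Complex.mul_conj]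
    simp only [u, map_sum, Finset.sum_mul_sum, map_mul, Complex.conj_conj]
    refine Finset.sum_congr rfl fun h _ => Finset.sum_congr rfl fun h' _ => ?_
    rw [sub_eq_add_neg, pair_add, pair_neg]; ring
  have hint : Integrable (fun χ => ((‖u χ‖ ^ 2 : ℝ) : ℂ)) ((ν p).restrict (Gperp p k)) := by
    simp only [hexp]
    exact integrable_finsetSum _ fun h _ => integrable_finsetSum _ fun h' _ =>
      (hpair _).mul_const _
  have hC : ∫ χ in Gperp p k, ((‖u χ‖ ^ 2 : ℝ) : ℂ) ∂(ν p) =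
      (((ν p).real (Gperp p k) * ∑ h ∈ T, ‖a h‖ ^ 2 : ℝ) : ℂ) := by
    simp only [hexp]
    rw [integral_finsetSum _ fun h _ => integrable_finsetSum _ fun h' _ =>
      (hpair _).mul_const _]
    push_cast
    rw [Finset.mul_sum]
    refine Finset.sum_congr rfl fun h hh => ?_
    rw [integral_finsetSum _ fun h' _ => (hpair _).mul_const _, Finset.sum_eq_single_of_mem h hh]
    · rw [integral_mul_const, setIntegral_Gperp_pair, if_pos (by simpa using zero_mem_G k),
        Complex.mul_conj, Complex.normSq_eq_norm_sq]
      push_cast; rfl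
    · intro h' _ hne
      rw [integral_mul_const, setIntegral_Gperp_pair,
        if_neg (fun H => hne (dil_H0_eq_of_sub_mem H)), zero_mul]
  have hR : ∫ χ in Gperp p k, ‖u χ‖ ^ 2 ∂(ν p) =
      (ν p).real (Gperp p k) * ∑ h ∈ T, ‖a h‖ ^ 2 := by
    rw [integral_complex_ofReal] at hC
    exact_mod_cast hC
  have hintR : Integrable (fun χ => ‖u χ‖ ^ 2) ((ν p).restrict (Gperp p k)) := by
    exact hint.re.congr (ae_of_all _ fun χ => Complex.ofReal_re _)
  have e : ∀ z : ℂ, ‖z‖ₑ ^ 2 = ENNReal.ofReal (‖z‖ ^ 2) := fun z => by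
    rw [ENNReal.ofReal_pow (norm_nonneg _), ofReal_norm]
  simp only [e]
  rw [← ofReal_integral_eq_lintegral_ofReal hintR (ae_of_all _ fun χ => sq_nonneg _), hR,
    ENNReal.ofReal_mul measureReal_nonneg, ENNReal.ofReal_sum_of_nonneg fun _ _ => sq_nonneg _,
    Measure.real, ENNReal.ofReal_toReal (ν_Gperp_ne_top k)]

/-- `G_m` has finite measure, and for `m ≤ k` it is a disjoint union of cosets of `G_k`, all of the
same positive measure. -/
theorem finite_H0_dil_mem (k m : ℤ) : {h : H0 p | dil (-k) (h : ℚ_[p]) ∈ G p m}.Finite := by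
  wlog hmk : m ≤ k generalizing m
  · exact (this k le_rfl).subset fun h hh => G_anti (by omega) hh
  have h1 := lintegral_eq_tsum_of_invariant k ((G p m).indicator 1) (fun x y hy => by
    by_cases hx : x ∈ G p m
    · simp [hx, (add_mem_G_iff (G_anti hmk hy)).2 hx]
    · simp [hx, mt (add_mem_G_iff (G_anti hmk hy)).1 hx])
  rw [lintegral_indicator_one (measurableSet_G m)] at h1
  have h2 : ∑' h : H0 p, (G p m).indicator (1 : ℚ_[p] → ℝ≥0∞) (dil (-k) h) ≠ ∞ := fun h => by
    rw [h, ENNReal.mul_top (μ_G_ne_zero k)] at h1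
    exact μ_G_ne_top m h1
  refine (ENNReal.finite_const_le_of_tsum_ne_top h2 one_ne_zero).subset fun h hh => ?_
  simp only [Set.mem_ofPred_eq] at hh ⊢
  simp [hh]

/-- A character in `G_k^⊥` is constant on each coset of `G_k`, so there the Fourier integral is a
trigonometric sum whose coefficients are the coset integrals of `g`. Compact support makes the sum
finite. -/
theorem setLIntegral_Gperp_FT {g : ℚ_[p] → ℂ} (hg : Integrable g (μ p)) {m : ℤ}
    (hs : ∀ x ∉ G p m, g x = 0) (k : ℤ) :
    ∫⁻ χ in Gperp p k, ‖FT g χ‖ₑ ^ 2 ∂(ν p) =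
      ν p (Gperp p k) * ∑' h : H0 p, ‖∫ x in cell k (dil (-k) h), g x ∂(μ p)‖ₑ ^ 2 := by
  wlog hmk : m ≤ k generalizing m
  · exact this (m := k) (fun x hx => hs x fun h => hx (G_anti (by omega) h)) le_rfl
  let T := (finite_H0_dil_mem (p := p) k m).toFinset
  have hcell : ∀ h : H0 p, ∀ x ∈ cell k (dil (-k) (h : ℚ_[p])), h ∉ T → g x = 0 := by
    intro h x hx hT
    refine hs x fun hxm => hT ?_
    have := sub_mem_G hxm (G_anti hmk hx)
    simpa [T] using this
  rw [tsum_eq_sum (s := T), ← setLIntegral_Gperp_sum]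
  · refine setLIntegral_congr_fun (measurableSet_Gperp k) fun χ hχ => ?_
    congr 2
    have hU : ∀ x, x ∉ ⋃ h ∈ T, cell k (dil (-k) (h : ℚ_[p])) → g x * conj (pair χ x) = 0 := by
      intro x hx
      obtain ⟨h, hh⟩ := exists_dil_H0 k x
      rw [hcell h x hh (fun hT => hx (Set.mem_biUnion (x := h) hT hh)), zero_mul]
    rw [FT, ← setIntegral_eq_integral_of_forall_compl_eq_zero hU, integral_biUnion_finset]
    · refine Finset.sum_congr rfl fun h _ => ?_
      rw [← integral_const_mul]
      refine setIntegral_congr_fun (measurableSet_cell _ _) fun x hx => ?_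
      have h1 : pair χ x = pair χ (dil (-k) h) := by
        simpa using pair_add_of_mem hχ (dil (-k) h) hx
      rw [h1, mul_comm]
    · exact fun h _ => measurableSet_cell _ _
    · exact fun h _ h' _ hne => pairwise_disjoint_cell k hne
    · exact fun h _ => (integrable_mul_conj_pair hg χ).integrableOn
  · intro h hT
    rw [setIntegral_eq_zero_of_forall_eq_zero fun x hx => hcell h x hx hT]
    simp

theorem cell_add {k : ℤ} (x : ℚ_[p]) {y : ℚ_[p]} (hy : y ∈ G p k) :
    cell k (x + y) = cell k x := by
  ext z
  rw [cell, cell, Set.mem_ofPred_eq, Set.mem_ofPred_eq, ← sub_sub, sub_eq_add_neg _ y,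
    add_mem_G_iff (neg_mem_G hy)]

theorem tsum_setIntegral_cell (g : ℚ_[p] → ℂ) (k : ℤ) :
    μ p (G p k) * ∑' h : H0 p, ‖∫ x in cell k (dil (-k) h), g x ∂(μ p)‖ₑ ^ 2 =
      ∫⁻ y, ‖∫ x in cell k y, g x ∂(μ p)‖ₑ ^ 2 ∂(μ p) := by
  rw [lintegral_eq_tsum_of_invariant k]
  intro x y hy
  rw [cell_add x hy]

theorem measureReal_G_pos (n : ℤ) : 0 < (μ p).real (G p n) :=
  ENNReal.toReal_pos (μ_G_ne_zero n) (μ_G_ne_top n)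

/-- The indicator of `G_m` has transform `μ(G_m)` times the indicator of `G_m^⊥`. Computing its
energy on `G_k^⊥` directly and through `setLIntegral_Gperp_FT` ties the two Haar normalisations
together. -/
theorem ν_Gperp_mul_of_le {m k : ℤ} (hmk : m ≤ k) :
    ν p (Gperp p m) * μ p (G p m) = ν p (Gperp p k) * μ p (G p k) := by
  classical
  let g : ℚ_[p] → ℂ := (G p m).indicator 1
  have hg : Integrable g (μ p) :=
    (integrable_indicator_iff (measurableSet_G m)).2
      (integrableOn_const (μ_G_ne_top m))
  have key := setLIntegral_Gperp_FT hg (m := m) (fun x hx => Set.indicator_of_notMem hx _) k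
  have hFT : ∀ χ, ‖FT g χ‖ₑ ^ 2 = (Gperp p m).indicator (fun _ => μ p (G p m) ^ 2) χ := by
    intro χ
    have : FT g χ = ∫ x in G p m, conj (pair χ x) ∂(μ p) := by
      rw [← integral_indicator (measurableSet_G m)]
      refine integral_congr_ae (ae_of_all _ fun x => ?_)
      by_cases hx : x ∈ G p m <;> simp [g, hx]
    rw [this, setIntegral_G_conj_pair]
    by_cases hχ : χ ∈ Gperp p m
    · rw [if_pos hχ, Set.indicator_of_mem hχ, ← ofReal_norm, Complex.norm_real, Real.norm_of_nonneg
        measureReal_nonneg, ofReal_measureReal (μ_G_ne_top m)]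
    · simp [hχ]
  have hcell : ∀ y, ‖∫ x in cell k y, g x ∂(μ p)‖ₑ ^ 2 =
      (G p m).indicator (fun _ => μ p (G p k) ^ 2) y := by
    intro y
    by_cases hy : y ∈ G p m
    · rw [setIntegral_congr_fun (g := fun _ => (1 : ℂ)) (measurableSet_cell k y)]
      · rw [Set.indicator_of_mem hy, setIntegral_const, Complex.real_smul, mul_one, ← ofReal_norm,
          Complex.norm_real, Real.norm_of_nonneg measureReal_nonneg, Measure.real, measure_cell,
          ENNReal.ofReal_toReal (μ_G_ne_top k)]
      · intro x hx
        have : x ∈ G p m := by simpa using add_mem_G hy (G_anti hmk hx)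
        simp [g, this]
    · rw [setIntegral_eq_zero_of_forall_eq_zero]
      · simp [hy]
      · intro x hx
        have : x ∉ G p m := fun h => hy (by simpa using sub_mem_G h (G_anti hmk hx))
        simp [g, this]
  have h1 := tsum_setIntegral_cell g k
  simp only [hFT] at key
  rw [lintegral_indicator (measurableSet_Gperp m), setLIntegral_const,
    Measure.restrict_apply (measurableSet_Gperp m),
    Set.inter_eq_left.2 (Gperp_mono hmk)] at key
  rw [lintegral_congr hcell, lintegral_indicator (measurableSet_G m), setLIntegral_const] at h1
  have h2 : μ p (G p m) * μ p (G p k) * (ν p (Gperp p m) * μ p (G p m)) =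
      μ p (G p m) * μ p (G p k) * (ν p (Gperp p k) * μ p (G p k)) := by
    calc _ = μ p (G p k) * (μ p (G p m) ^ 2 * ν p (Gperp p m)) := by ring
      _ = ν p (Gperp p k) * (μ p (G p k) ^ 2 * μ p (G p m)) := by rw [key, ← h1]; ring
      _ = _ := by ring
  exact (ENNReal.mul_right_inj (mul_ne_zero (μ_G_ne_zero m) (μ_G_ne_zero k))
    (ENNReal.mul_ne_top (μ_G_ne_top m) (μ_G_ne_top k))).1 h2

theorem ν_Gperp (k : ℤ) : ν p (Gperp p k) = (μ p (G p k))⁻¹ := by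
  refine ENNReal.eq_inv_of_mul_eq_one_left ?_
  rcases le_total k 0 with h | h
  · rw [ν_Gperp_mul_of_le h, ν_Gperp_zero, μ_G_zero, one_mul]
  · rw [← ν_Gperp_mul_of_le h, ν_Gperp_zero, μ_G_zero, one_mul]

/-- The energy of the Fourier transform in a coset of `G_k^⊥`. -/
theorem setLIntegral_coset_FT {g : ℚ_[p] → ℂ} (hg : Integrable g (μ p)) {m : ℤ}
    (hs : ∀ x ∉ G p m, g x = 0) (k : ℤ) (η : X p) :
    ∫⁻ χ in coset k η, ‖FT g χ‖ₑ ^ 2 ∂(ν p) = (μ p (G p k))⁻¹ *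
      ∑' h : H0 p, ‖∫ x in cell k (dil (-k) h), g x * conj (pair η x) ∂(μ p)‖ₑ ^ 2 := by
  rw [setLIntegral_coset, ← ν_Gperp, ← setLIntegral_Gperp_FT (m := m)
    (integrable_mul_conj_pair hg η) (fun x hx => by rw [hs x hx, zero_mul])]
  congr 1; ext χ
  congr 2
  refine integral_congr_ae (ae_of_all _ fun x => ?_)
  simp only [pair_mul, map_mul]; ring

theorem tsum_setIntegral_cell_le {g : ℚ_[p] → ℂ} (hg : AEStronglyMeasurable g (μ p)) (k : ℤ) :
    (μ p (G p k))⁻¹ * ∑' h : H0 p, ‖∫ x in cell k (dil (-k) h), g x ∂(μ p)‖ₑ ^ 2 ≤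
      ∫⁻ x, ‖g x‖ₑ ^ 2 ∂(μ p) := by
  rw [lintegral_eq_tsum k, ← ENNReal.tsum_mul_left]
  refine ENNReal.tsum_le_tsum fun h => ?_
  calc _ ≤ (μ p (G p k))⁻¹ * (μ p (G p k) * ∫⁻ x in cell k (dil (-k) h), ‖g x‖ₑ ^ 2 ∂(μ p)) := by
        gcongr
        rw [← measure_cell k (dil (-k) h)]
        exact enorm_setIntegral_sq_le hg _
    _ = _ := by
        rw [← mul_assoc, ENNReal.inv_mul_cancel (μ_G_ne_zero k) (μ_G_ne_top k), one_mul]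

theorem iUnion_Gperp : ⋃ n : ℕ, Gperp p n = Set.univ :=
  Set.eq_univ_of_forall fun χ => Set.mem_iUnion.2 (exists_mem_Gperp χ)

/-- The coset `y + G_k` is the closed ball of radius `p ^ (-k)` about `y`, so this is Lebesgue
differentiation. -/
theorem ae_tendsto_setAverage_cell {g : ℚ_[p] → ℂ} (hg : Integrable g (μ p)) :
    ∀ᵐ y ∂(μ p), Tendsto (fun k : ℕ => ⨍ x in cell k y, g x ∂(μ p)) atTop (𝓝 (g y)) := by
  filter_upwards [IsUnifLocDoublingMeasure.ae_tendsto_average (μ p) hg.locallyIntegrable 1]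
    with y hy
  have h0 : Tendsto (fun k : ℕ => (p : ℝ) ^ (-(k : ℤ))) atTop (𝓝[>] 0) := by
    refine tendsto_nhdsWithin_iff.2 ⟨?_, .of_forall fun k => zpow_pos prime_pos _⟩
    simp only [zpow_neg, zpow_natCast, ← inv_pow]
    exact tendsto_pow_atTop_nhds_zero_of_lt_one (inv_nonneg.2 prime_pos.le)
      (inv_lt_one_of_one_lt₀ one_lt_prime)
  have h := hy (fun _ : ℕ => y) _ h0 (.of_forall fun k =>
    Metric.mem_closedBall_self (by rw [one_mul]; exact (zpow_pos prime_pos _).le))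
  refine h.congr fun k => ?_
  have : Metric.closedBall y ((p : ℝ) ^ (-(k : ℤ))) = cell k y := by
    ext x; simp [cell, mem_G, dist_eq_norm]
  rw [this]

theorem lintegral_enorm_setAverage_cell (g : ℚ_[p] → ℂ) (k : ℤ) :
    ∫⁻ y, ‖⨍ x in cell k y, g x ∂(μ p)‖ₑ ^ 2 ∂(μ p) =
      (μ p (G p k))⁻¹ * ∑' h : H0 p, ‖∫ x in cell k (dil (-k) h), g x ∂(μ p)‖ₑ ^ 2 := by
  have hc : ∀ y, ‖⨍ x in cell k y, g x ∂(μ p)‖ₑ ^ 2 =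
      (μ p (G p k))⁻¹ ^ 2 * ‖∫ x in cell k y, g x ∂(μ p)‖ₑ ^ 2 := by
    intro y
    rw [setAverage_eq, enorm_smul, mul_pow, Measure.real, measure_cell, ← ENNReal.toReal_inv,
      Real.enorm_of_nonneg ENNReal.toReal_nonneg,
      ENNReal.ofReal_toReal (ENNReal.inv_ne_top.2 (μ_G_ne_zero k))]
  simp only [hc]
  rw [lintegral_const_mul' _ _ (ENNReal.pow_ne_top (ENNReal.inv_ne_top.2 (μ_G_ne_zero k))),
    ← tsum_setIntegral_cell, ← mul_assoc, sq, mul_assoc _ _ (μ p (G p k)),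
    ENNReal.inv_mul_cancel (μ_G_ne_zero k) (μ_G_ne_top k), mul_one]

/-- The Plancherel theorem for square-integrable functions of compact support. -/
theorem lintegral_FT_sq {g : ℚ_[p] → ℂ} (hg : Integrable g (μ p)) {m : ℤ}
    (hs : ∀ x ∉ G p m, g x = 0) :
    ∫⁻ χ, ‖FT g χ‖ₑ ^ 2 ∂(ν p) = ∫⁻ x, ‖g x‖ₑ ^ 2 ∂(μ p) := by
  have hI : ∀ k : ℤ, ∫⁻ χ in Gperp p k, ‖FT g χ‖ₑ ^ 2 ∂(ν p) = (μ p (G p k))⁻¹ *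
      ∑' h : H0 p, ‖∫ x in cell k (dil (-k) h), g x ∂(μ p)‖ₑ ^ 2 := fun k => by
    rw [setLIntegral_Gperp_FT hg hs, ν_Gperp]
  apply le_antisymm
  -- Cauchy–Schwarz on cosets bounds the energy on every `G_k^⊥`, and these sets exhaust `X`.
  · rw [← setLIntegral_univ, ← iUnion_Gperp, setLIntegral_iUnion_of_directed]
    · exact iSup_le fun k => (hI k).trans_le (tsum_setIntegral_cell_le hg.1 k)
    · exact Monotone.directed_le fun a b hab => Gperp_mono (by exact_mod_cast hab)
  -- Conversely, the coset averages converge to `g` almost everywhere and their energy equals that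
  -- of the transform on `G_k^⊥`; Fatou's lemma concludes.
  · calc ∫⁻ x, ‖g x‖ₑ ^ 2 ∂(μ p)
        = ∫⁻ y, liminf (fun k : ℕ => ‖⨍ x in cell k y, g x ∂(μ p)‖ₑ ^ 2) atTop ∂(μ p) := by
          refine lintegral_congr_ae ?_
          filter_upwards [ae_tendsto_setAverage_cell hg] with y hy
          exact ((ENNReal.continuous_pow 2).tendsto _ |>.comp hy.enorm).liminf_eq.symm
      _ ≤ liminf (fun k : ℕ => ∫⁻ y, ‖⨍ x in cell k y, g x ∂(μ p)‖ₑ ^ 2 ∂(μ p)) atTop := by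
          refine lintegral_liminf_le fun k => Continuous.measurable ?_
          refine continuous_of_add_invariant (k := k) fun x y hy => ?_
          rw [cell_add x hy]
      _ ≤ _ := by
          refine liminf_le_of_le (by isBoundedDefault) fun b hb => ?_
          obtain ⟨k, hk⟩ := hb.exists
          refine hk.trans ?_
          rw [lintegral_enorm_setAverage_cell, ← hI]
          exact setLIntegral_le_lintegral _ _

/-! ### The Fourier transform on `L_2` -/

/-- The restriction of `f` to `G_{-n}`, extended by `0`. -/
def trunc (n : ℕ) (f : ℚ_[p] → ℂ) : ℚ_[p] → ℂ := (G p (-(n : ℤ))).indicator f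

theorem trunc_of_notMem {n : ℕ} (f : ℚ_[p] → ℂ) (x : ℚ_[p]) (hx : x ∉ G p (-(n : ℤ))) :
    trunc n f x = 0 := Set.indicator_of_notMem hx f

theorem memLp_trunc {f : ℚ_[p] → ℂ} (hf : MemLp f 2 (μ p)) (n : ℕ) :
    MemLp (trunc n f) 2 (μ p) := hf.indicator (measurableSet_G _)

theorem integrable_of_memLp {g : ℚ_[p] → ℂ} (hg : MemLp g 2 (μ p)) {m : ℤ}
    (hs : ∀ x ∉ G p m, g x = 0) : Integrable g (μ p) := by
  have : IsFiniteMeasure ((μ p).restrict (G p m)) := isFiniteMeasure_restrict.2 (μ_G_ne_top m)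
  exact IntegrableOn.integrable_of_forall_notMem_eq_zero
    ((hg.restrict (G p m)).integrable (by norm_num)) hs

theorem integrable_trunc {f : ℚ_[p] → ℂ} (hf : MemLp f 2 (μ p)) (n : ℕ) :
    Integrable (trunc n f) (μ p) :=
  integrable_of_memLp (memLp_trunc hf n) (trunc_of_notMem f)

theorem setIntegral_eq_FT_trunc (f : ℚ_[p] → ℂ) (n : ℕ) (χ : X p) :
    ∫ x in G p (-(n : ℤ)), f x * conj (pair χ x) ∂(μ p) = FT (trunc n f) χ := by
  rw [← integral_indicator (measurableSet_G _)]
  refine integral_congr_ae (ae_of_all _ fun x => ?_)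
  by_cases hx : x ∈ G p (-(n : ℤ)) <;> simp [trunc, hx]

theorem isFourier_iff {f : ℚ_[p] → ℂ} {F : X p → ℂ} : IsFourier f F ↔ MemLp F 2 (ν p) ∧
    Tendsto (fun n : ℕ => eLpNorm (F - FT (trunc n f)) 2 (ν p)) atTop (𝓝 0) := by
  simp only [IsFourier, setIntegral_eq_FT_trunc]; rfl

theorem FT_sub {g g' : ℚ_[p] → ℂ} (hg : Integrable g (μ p)) (hg' : Integrable g' (μ p)) :
    FT (g - g') = FT g - FT g' := by
  ext χ
  simp only [FT, Pi.sub_apply, sub_mul]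
  exact integral_sub (integrable_mul_conj_pair hg χ) (integrable_mul_conj_pair hg' χ)

theorem eLpNorm_FT {g : ℚ_[p] → ℂ} (hg : Integrable g (μ p)) {m : ℤ}
    (hs : ∀ x ∉ G p m, g x = 0) : eLpNorm (FT g) 2 (ν p) = eLpNorm g 2 (μ p) := by
  rw [eLpNorm_two_eq, eLpNorm_two_eq, lintegral_FT_sq hg hs]

theorem memLp_FT {g : ℚ_[p] → ℂ} (hg : MemLp g 2 (μ p)) {m : ℤ}
    (hs : ∀ x ∉ G p m, g x = 0) : MemLp (FT g) 2 (ν p) := by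
  refine ⟨(continuous_FT hs).aestronglyMeasurable, ?_⟩
  rw [eLpNorm_FT (integrable_of_memLp hg hs) hs]
  exact hg.2

theorem eventually_mem_G (x : ℚ_[p]) : ∀ᶠ n : ℕ in atTop, x ∈ G p (-(n : ℤ)) := by
  obtain ⟨n, hn⟩ := exists_mem_G x
  filter_upwards [eventually_ge_atTop n] with m hm
  exact G_anti (by omega) hn

theorem tendsto_trunc {f : ℚ_[p] → ℂ} (hf : MemLp f 2 (μ p)) :
    Tendsto (fun n : ℕ => eLpNorm (trunc n f - f) 2 (μ p)) atTop (𝓝 0) := by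
  have hfin : ∫⁻ x, ‖f x‖ₑ ^ 2 ∂(μ p) ≠ ∞ := by
    rw [← eLpNorm_two_sq]; exact ENNReal.pow_ne_top hf.2.ne
  have h : Tendsto (fun n : ℕ => ∫⁻ x, ‖(trunc n f - f) x‖ₑ ^ 2 ∂(μ p)) atTop
      (𝓝 (∫⁻ _, 0 ∂(μ p))) := by
    refine tendsto_lintegral_of_dominated_convergence' (fun x => ‖f x‖ₑ ^ 2) (fun n => ?_)
      (fun n => ae_of_all _ fun x => ?_) hfin (ae_of_all _ fun x => ?_)
    · exact ((memLp_trunc hf n).sub hf).1.enorm.pow_const 2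
    · by_cases hx : x ∈ G p (-(n : ℤ)) <;> simp [trunc, hx]
    · refine tendsto_const_nhds.congr' ?_
      filter_upwards [eventually_mem_G x] with n hn
      simp [trunc, hn]
  simp only [eLpNorm_two_eq]
  rw [lintegral_zero] at h
  have h2 := (ENNReal.continuous_rpow_const (y := (1 / 2 : ℝ))).tendsto 0 |>.comp h
  rwa [ENNReal.zero_rpow_of_pos (by norm_num)] at h2

theorem exists_isFourier {f : ℚ_[p] → ℂ} (hf : MemLp f 2 (μ p)) : ∃ F, IsFourier f F := by
  let u : ℕ → Lp ℂ 2 (μ p) := fun n => (memLp_trunc hf n).toLp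
  let v : ℕ → Lp ℂ 2 (ν p) := fun n => (memLp_FT (memLp_trunc hf n) (trunc_of_notMem f)).toLp
  have hu : Tendsto u atTop (𝓝 hf.toLp) :=
    (Lp.tendsto_Lp_iff_tendsto_eLpNorm'' _ (memLp_trunc hf) _ hf).2 (tendsto_trunc hf)
  -- Differences of truncations have compact support, so the transforms inherit the Cauchy property
  -- isometrically.
  have huv : ∀ n m, dist (v n) (v m) = dist (u n) (u m) := fun n m => by
    have hs : ∀ x ∉ G p (-((max n m : ℕ) : ℤ)), (trunc n f - trunc m f) x = 0 := fun x hx => by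
      rw [Pi.sub_apply, trunc_of_notMem, trunc_of_notMem, sub_zero]
      · exact fun h => hx (G_anti (by simp) h)
      · exact fun h => hx (G_anti (by simp) h)
    simp only [u, v, dist_edist, Lp.edist_toLp_toLp]
    rw [← FT_sub (integrable_trunc hf n) (integrable_trunc hf m),
      eLpNorm_FT ((integrable_trunc hf n).sub (integrable_trunc hf m)) hs]
  have hv : CauchySeq v := by
    have := hu.cauchySeq
    rw [Metric.cauchySeq_iff] at this ⊢
    simpa only [huv] using this
  obtain ⟨F, hF⟩ := cauchySeq_tendsto_of_complete hv
  refine ⟨F, isFourier_iff.2 ⟨Lp.memLp F, ?_⟩⟩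
  have := (Lp.tendsto_Lp_iff_tendsto_eLpNorm'' _
    (fun n => memLp_FT (memLp_trunc hf n) (trunc_of_notMem f)) _ (Lp.memLp F)).1
    (by simpa [v, Lp.toLp_coeFn] using hF)
  refine this.congr fun n => ?_
  rw [eLpNorm_sub_comm]

theorem isFourier_fourier {f : ℚ_[p] → ℂ} (hf : MemLp f 2 (μ p)) : IsFourier f (fourier f) := by
  have h := exists_isFourier hf
  rw [fourier, dif_pos h]
  exact h.choose_spec

/-- Convergence in `L_2` implies convergence of the `L_2`-norms. -/
theorem tendsto_eLpNorm_of_tendsto_sub {α : Type*} [MeasurableSpace α] {m : Measure α}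
    {F : α → ℂ} {u : ℕ → α → ℂ} (hF : MemLp F 2 m) (hu : ∀ n, AEStronglyMeasurable (u n) m)
    (h : Tendsto (fun n => eLpNorm (F - u n) 2 m) atTop (𝓝 0)) :
    Tendsto (fun n => eLpNorm (u n) 2 m) atTop (𝓝 (eLpNorm F 2 m)) := by
  have h1 : Tendsto (fun n => eLpNorm F 2 m - eLpNorm (F - u n) 2 m) atTop
      (𝓝 (eLpNorm F 2 m)) := by
    simpa using ENNReal.Tendsto.sub tendsto_const_nhds h (Or.inl hF.2.ne)
  have h2 : Tendsto (fun n => eLpNorm F 2 m + eLpNorm (F - u n) 2 m) atTop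
      (𝓝 (eLpNorm F 2 m)) := by
    simpa using (tendsto_const_nhds (x := eLpNorm F 2 m)).add h
  refine tendsto_of_tendsto_of_tendsto_of_le_of_le h1 h2 (fun n => ?_) (fun n => ?_)
  · refine tsub_le_iff_right.2 ?_
    simpa using eLpNorm_add_le (hu n) (hF.1.sub (hu n)) (by norm_num : (1 : ℝ≥0∞) ≤ 2)
  · have := eLpNorm_sub_le hF.1 (hF.1.sub (hu n)) (by norm_num : (1 : ℝ≥0∞) ≤ 2)
    simpa using this

theorem tendsto_setLIntegral_FT_trunc {f : ℚ_[p] → ℂ} {F : X p → ℂ} (hF : IsFourier f F)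
    (S : Set (X p)) :
    Tendsto (fun n : ℕ => ∫⁻ χ in S, ‖FT (trunc n f) χ‖ₑ ^ 2 ∂(ν p)) atTop
      (𝓝 (∫⁻ χ in S, ‖F χ‖ₑ ^ 2 ∂(ν p))) := by
  obtain ⟨h1, h2⟩ := isFourier_iff.1 hF
  have h3 := tendsto_eLpNorm_of_tendsto_sub (m := (ν p).restrict S) (u := fun n => FT (trunc n f))
    (h1.restrict S)
    (fun n => (continuous_FT (trunc_of_notMem f)).aestronglyMeasurable)
    (tendsto_of_tendsto_of_tendsto_of_le_of_le tendsto_const_nhds h2 (fun _ => zero_le)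
      (fun n => eLpNorm_mono_measure _ Measure.restrict_le_self))
  simp only [← eLpNorm_two_sq]
  exact ((ENNReal.continuous_pow 2).tendsto _).comp h3

/-- The Plancherel theorem. -/
theorem IsFourier.lintegral_sq {f : ℚ_[p] → ℂ} {F : X p → ℂ} (hf : MemLp f 2 (μ p))
    (hF : IsFourier f F) : ∫⁻ χ, ‖F χ‖ₑ ^ 2 ∂(ν p) = ∫⁻ x, ‖f x‖ₑ ^ 2 ∂(μ p) := by
  have h1 := tendsto_setLIntegral_FT_trunc hF Set.univ
  simp only [setLIntegral_univ, fun n => lintegral_FT_sq (integrable_trunc hf n)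
    (trunc_of_notMem f)] at h1
  have h2 := tendsto_eLpNorm_of_tendsto_sub hf (fun n => (memLp_trunc hf n).1)
    ((tendsto_trunc hf).congr fun n => eLpNorm_sub_comm _ _ _ _)
  have h3 := ((ENNReal.continuous_pow 2).tendsto _).comp h2
  simp only [Function.comp_def, eLpNorm_two_sq] at h3
  exact tendsto_nhds_unique h1 h3

theorem IsFourier.sub {f g : ℚ_[p] → ℂ} {F F' : X p → ℂ} (hf : MemLp f 2 (μ p))
    (hg : MemLp g 2 (μ p)) (hF : IsFourier f F) (hF' : IsFourier g F') :
    IsFourier (f - g) (F - F') := by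
  rw [isFourier_iff] at *
  refine ⟨hF.1.sub hF'.1, ?_⟩
  have h := hF.2.add hF'.2
  rw [add_zero] at h
  refine tendsto_of_tendsto_of_tendsto_of_le_of_le tendsto_const_nhds h (fun _ => zero_le)
    fun n => ?_
  have e : F - F' - FT (trunc n (f - g)) = (F - FT (trunc n f)) - (F' - FT (trunc n g)) := by
    have : trunc n (f - g) = trunc n f - trunc n g := Set.indicator_sub' _ _ _
    rw [this, FT_sub (integrable_trunc hf n) (integrable_trunc hg n)]
    abel
  rw [e]
  exact eLpNorm_sub_le
    (hF.1.1.sub (continuous_FT (trunc_of_notMem f)).aestronglyMeasurable)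
    (hF'.1.1.sub (continuous_FT (trunc_of_notMem g)).aestronglyMeasurable) (by norm_num)

theorem IsFourier.congr {f : ℚ_[p] → ℂ} {F F' : X p → ℂ} (hF : IsFourier f F)
    (h : F =ᵐ[ν p] F') : IsFourier f F' := by
  rw [isFourier_iff] at *
  refine ⟨hF.1.ae_eq h, hF.2.congr fun n => eLpNorm_congr_ae ?_⟩
  filter_upwards [h] with χ hχ
  simp [hχ]

/-- An `L_2`-function is determined by its Fourier transform. -/
theorem IsFourier.ae_eq {f g : ℚ_[p] → ℂ} {F : X p → ℂ} (hf : MemLp f 2 (μ p))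
    (hg : MemLp g 2 (μ p)) (hF : IsFourier f F) (hF' : IsFourier g F) : f =ᵐ[μ p] g := by
  have h := (hF.sub hf hg hF').lintegral_sq (hf.sub hg)
  simp only [sub_self, Pi.zero_apply, enorm_zero, ne_eq, OfNat.ofNat_ne_zero, not_false_eq_true,
    zero_pow, lintegral_zero] at h
  have h2 := (lintegral_eq_zero_iff' ((hf.sub hg).1.enorm.pow_const 2)).1 h.symm
  filter_upwards [h2] with x hx
  have : ‖(f - g) x‖ₑ ^ 2 = 0 := hx
  simpa [sub_eq_zero] using this

/-- The Fourier transform of a function of compact support is its Fourier integral. -/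
theorem isFourier_FT {g : ℚ_[p] → ℂ} (hg : MemLp g 2 (μ p)) {m : ℕ}
    (hs : ∀ x ∉ G p (-(m : ℤ)), g x = 0) : IsFourier g (FT g) := by
  refine isFourier_iff.2 ⟨memLp_FT hg hs, tendsto_const_nhds.congr' ?_⟩
  filter_upwards [eventually_ge_atTop m] with n hn
  have : trunc n g = g := by
    ext x
    by_cases hx : x ∈ G p (-(n : ℤ))
    · simp [trunc, hx]
    · rw [trunc_of_notMem g x hx, hs x fun h => hx (G_anti (by omega) h)]
  rw [this, sub_self, eLpNorm_zero]

theorem cell_subset_or_disjoint {m k : ℤ} (hmk : m ≤ k) (z : ℚ_[p]) :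
    cell k z ⊆ G p m ∨ Disjoint (cell k z) (G p m) := by
  by_cases hz : z ∈ G p m
  · left; intro x hx
    simpa using add_mem_G (G_anti hmk hx) hz
  · right
    exact Set.disjoint_left.2 fun x hx hxm => hz (by simpa using sub_mem_G hxm (G_anti hmk hx))

/-- The energy of the Fourier transform in a coset of `G_k^⊥`. -/
theorem IsFourier.setLIntegral_coset {f : ℚ_[p] → ℂ} {F : X p → ℂ} (hf : MemLp f 2 (μ p))
    (hF : IsFourier f F) (k : ℤ) (η : X p) :
    ∫⁻ χ in coset k η, ‖F χ‖ₑ ^ 2 ∂(ν p) = (μ p (G p k))⁻¹ *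
      ∑' h : H0 p, ‖∫ x in cell k (dil (-k) h), f x * conj (pair η x) ∂(μ p)‖ₑ ^ 2 := by
  have hlim := tendsto_setLIntegral_FT_trunc hF (coset k η)
  simp only [fun n => setLIntegral_coset_FT (integrable_trunc hf n) (trunc_of_notMem f) k η]
    at hlim
  have heq : ∀ (n : ℕ) (z : ℚ_[p]), cell k z ⊆ G p (-(n : ℤ)) →
      ∫ x in cell k z, trunc n f x * conj (pair η x) ∂(μ p) =
        ∫ x in cell k z, f x * conj (pair η x) ∂(μ p) := fun n z hz =>
    setIntegral_congr_fun (measurableSet_cell k z) fun x hx => by simp [trunc, hz hx]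
  apply le_antisymm
  · refine le_of_tendsto hlim ?_
    -- Once `-n ≤ k`, every coset of `G_k` is inside or disjoint from `G_{-n}`: each truncated coset
    -- integral is the full one or zero.
    filter_upwards [eventually_ge_atTop (-k).toNat] with n hn
    gcongr with h
    rcases cell_subset_or_disjoint (m := -(n : ℤ)) (k := k) (by omega) (dil (-k) (h : ℚ_[p]))
      with H | H
    · rw [heq n _ H]
    · rw [setIntegral_eq_zero_of_forall_eq_zero]
      · simp
      · intro x hx
        rw [trunc_of_notMem f x (Set.disjoint_left.1 H hx), zero_mul]
  -- Any finite set of cosets is eventually contained in `G_{-n}`, so every finite partial sum is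
  -- attained by the truncations.
  · rw [ENNReal.tsum_eq_iSup_sum, ENNReal.mul_iSup]
    refine iSup_le fun T => ge_of_tendsto hlim ?_
    have h1 : ∀ᶠ n : ℕ in atTop, ∀ h ∈ T, cell k (dil (-k) (h : ℚ_[p])) ⊆ G p (-(n : ℤ)) := by
      refine (T.eventually_all).2 fun h _ => ?_
      filter_upwards [eventually_mem_G (dil (-k) (h : ℚ_[p])), eventually_ge_atTop (-k).toNat]
        with n hn hk x hx
      simpa using add_mem_G (G_anti (by omega) hx) hn
    filter_upwards [h1] with n hn
    gcongr
    refine le_trans (Finset.sum_le_sum fun h hh => ?_) (ENNReal.sum_le_tsum T)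
    rw [heq n _ (hn h hh)]

/-! ### Wavelets with spectrum in a coset -/

/-- The image of Haar measure under an automorphism is again a Haar measure, hence a multiple of it.
This lets `ψ` be replaced by an almost everywhere equal function inside every `wav`. -/
theorem quasiMeasurePreserving_dil_sub (n : ℤ) (h : ℚ_[p]) :
    Measure.QuasiMeasurePreserving (fun x => dil n x - h) (μ p) (μ p) := by
  let L : ℚ_[p] ≃+ ℚ_[p] :=
    { toFun := dil n
      invFun := dil (-n)
      left_inv := fun x => by simp [dil_dil, dil_zero_left]
      right_inv := fun x => by simp [dil_dil, dil_zero_left]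
      map_add' := dil_add n }
  have hc : ∀ k : ℤ, Continuous (dil k : ℚ_[p] → ℚ_[p]) := fun k => continuous_const_mul _
  have hmap : (Measure.map L (μ p)).IsAddHaarMeasure :=
    L.isAddHaarMeasure_map (μ p) (hc n) (hc (-n))
  have h1 : Measure.QuasiMeasurePreserving (dil n) (μ p) (μ p) := by
    refine ⟨(hc n).measurable, ?_⟩
    change Measure.map L (μ p) ≪ μ p
    rw [Measure.isAddLeftInvariant_eq_smul (Measure.map L (μ p)) (μ p)]
    exact Measure.smul_absolutelyContinuous
  exact (measurePreserving_sub_right (μ p) h).quasiMeasurePreserving.comp h1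

theorem wav_congr_ae {ψ ψ' : ℚ_[p] → ℂ} (h : ψ =ᵐ[μ p] ψ') (n : ℤ) (z : ℚ_[p]) :
    wav ψ n z =ᵐ[μ p] wav ψ' n z := by
  filter_upwards [(quasiMeasurePreserving_dil_sub n z).ae h] with x hx
  rw [wav, wav, hx]

theorem innerL2_congr_ae (f : ℚ_[p] → ℂ) {g g' : ℚ_[p] → ℂ} (h : g =ᵐ[μ p] g') :
    innerL2 f g = innerL2 f g' := by
  refine integral_congr_ae ?_
  filter_upwards [h] with x hx
  rw [hx]

/-- The function whose Fourier transform is the indicator of the coset `η G_{-s}^⊥`. -/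
def cosetWavelet (s : ℕ) (η : X p) (x : ℚ_[p]) : ℂ :=
  (((μ p).real (G p (-(s : ℤ))))⁻¹ : ℝ) * (G p (-(s : ℤ))).indicator (pair η) x

theorem memLp_indicator_pair {S : Set ℚ_[p]} (hS : MeasurableSet S) (hS' : μ p S ≠ ∞) (η : X p) :
    MemLp (S.indicator (pair η)) 2 (μ p) := by
  have : IsFiniteMeasure ((μ p).restrict S) := isFiniteMeasure_restrict.2 hS'
  exact (memLp_indicator_iff_restrict hS).2
    (.of_bound (continuous_pair η).aestronglyMeasurable 1 (ae_of_all _ fun x => (norm_pair η x).le))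

theorem memLp_cosetWavelet (s : ℕ) (η : X p) : MemLp (cosetWavelet s η) 2 (μ p) :=
  (memLp_indicator_pair (measurableSet_G _) (μ_G_ne_top _) η).const_mul _

theorem FT_cosetWavelet (s : ℕ) (η : X p) :
    FT (cosetWavelet s η) = (coset (-(s : ℤ)) η).indicator 1 := by
  classical
  ext χ
  have h : FT (cosetWavelet s η) χ = (((μ p).real (G p (-(s : ℤ))))⁻¹ : ℝ) *
      ∫ x in G p (-(s : ℤ)), conj (pair (χ * η⁻¹) x) ∂(μ p) := by
    rw [FT, ← integral_const_mul, ← integral_indicator (measurableSet_G _)]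
    refine integral_congr_ae (ae_of_all _ fun x => ?_)
    by_cases hx : x ∈ G p (-(s : ℤ))
    · simp [cosetWavelet, hx, pair_mul, pair_inv, mul_assoc, mul_comm (pair η x)]
    · simp [cosetWavelet, hx]
  rw [h, setIntegral_G_conj_pair]
  by_cases hχ : χ * η⁻¹ ∈ Gperp p (-(s : ℤ))
  · rw [if_pos hχ, Set.indicator_of_mem (show χ ∈ coset _ η from hχ), Pi.one_apply,
      ← Complex.ofReal_mul, inv_mul_cancel₀ (measureReal_G_pos _).ne', Complex.ofReal_one]
  · rw [if_neg hχ, Set.indicator_of_notMem (show χ ∉ coset _ η from hχ), mul_zero]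

theorem ae_eq_cosetWavelet {ψ : ℚ_[p] → ℂ} (hψ : MemLp ψ 2 (μ p)) {s : ℕ} {η : X p}
    (h : fourier ψ =ᵐ[ν p] (coset (-(s : ℤ)) η).indicator 1) : ψ =ᵐ[μ p] cosetWavelet s η := by
  refine ((isFourier_fourier hψ).congr h).ae_eq hψ (memLp_cosetWavelet s η) ?_
  rw [← FT_cosetWavelet]
  exact isFourier_FT (memLp_cosetWavelet s η) (m := s) fun x hx => by simp [cosetWavelet, hx]

theorem wav_cosetWavelet (s : ℕ) (η : X p) (n : ℤ) (h x : ℚ_[p]) :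
    wav (cosetWavelet s η) n h x =
      ((((p : ℝ) ^ ((n : ℝ) / 2) * ((μ p).real (G p (-(s : ℤ))))⁻¹ : ℝ) : ℂ) * conj (pair η h)) *
        (cell (n - s) (dil (-n) h)).indicator (pair (dilChar n η)) x := by
  have e : dil n x - h = dil n (x - dil (-n) h) := by
    rw [dil_sub, dil_dil, add_neg_cancel, dil_zero_left]
  have hiff : dil n x - h ∈ G p (-(s : ℤ)) ↔ x ∈ cell (n - s) (dil (-n) h) := by
    rw [e, dil_mem_G, cell, Set.mem_ofPred_eq, neg_add_eq_sub]
  by_cases hx : x ∈ cell (n - s) (dil (-n) h)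
  · rw [wav, cosetWavelet, Set.indicator_of_mem hx, Set.indicator_of_mem (hiff.2 hx),
      sub_eq_add_neg, pair_add, pair_neg, pair_dilChar]
    push_cast; ring
  · rw [wav, cosetWavelet, Set.indicator_of_notMem hx, Set.indicator_of_notMem (mt hiff.1 hx)]
    simp

theorem memLp_wav_cosetWavelet (s : ℕ) (η : X p) (n : ℤ) (h : ℚ_[p]) :
    MemLp (wav (cosetWavelet s η) n h) 2 (μ p) := by
  rw [funext (wav_cosetWavelet s η n h)]
  refine (memLp_indicator_pair (measurableSet_cell _ _) ?_ _).const_mul _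
  rw [measure_cell]
  exact μ_G_ne_top _

theorem enorm_innerL2_wav_cosetWavelet (f : ℚ_[p] → ℂ) (s : ℕ) (η : X p) (n : ℤ) (h : ℚ_[p]) :
    ‖innerL2 f (wav (cosetWavelet s η) n h)‖ₑ ^ 2 =
      (p : ℝ≥0∞) ^ n * (p : ℝ≥0∞) ^ (-(2 * s : ℤ)) *
        ‖∫ x in cell (n - s) (dil (-n) h), f x * conj (pair (dilChar n η) x) ∂(μ p)‖ₑ ^ 2 := by
  have hp : (p : ℝ≥0∞) ≠ 0 := by exact_mod_cast (Fact.out : p.Prime).ne_zero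
  have hp' : (p : ℝ≥0∞) ≠ ∞ := ENNReal.natCast_ne_top p
  have e : innerL2 f (wav (cosetWavelet s η) n h) =
      ((((p : ℝ) ^ ((n : ℝ) / 2) * ((μ p).real (G p (-(s : ℤ))))⁻¹ : ℝ) : ℂ) * pair η h) *
        ∫ x in cell (n - s) (dil (-n) h), f x * conj (pair (dilChar n η) x) ∂(μ p) := by
    rw [innerL2, ← integral_const_mul, ← integral_indicator (measurableSet_cell _ _)]
    refine integral_congr_ae (ae_of_all _ fun x => ?_)
    simp only [wav_cosetWavelet]
    by_cases hx : x ∈ cell (n - s) (dil (-n) h)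
    · rw [Set.indicator_of_mem hx, Set.indicator_of_mem hx]
      simp only [map_mul, Complex.conj_ofReal, Complex.conj_conj]; ring
    · simp [hx]
  have e1 : ‖(((p : ℝ) ^ ((n : ℝ) / 2) : ℝ) : ℂ)‖ₑ ^ 2 = (p : ℝ≥0∞) ^ n := by
    rw [← ofReal_norm, Complex.norm_real, Real.norm_of_nonneg (Real.rpow_nonneg prime_pos.le _),
      ← ENNReal.ofReal_rpow_of_pos prime_pos, ENNReal.ofReal_natCast, ← ENNReal.rpow_natCast,
      ← ENNReal.rpow_mul, ← ENNReal.rpow_intCast]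
    congr 1; push_cast; ring
  have e2 : ‖((((μ p).real (G p (-(s : ℤ))))⁻¹ : ℝ) : ℂ)‖ₑ ^ 2 = (p : ℝ≥0∞) ^ (-(2 * s : ℤ)) := by
    rw [← ofReal_norm, Complex.norm_real, Real.norm_of_nonneg (inv_nonneg.2 measureReal_nonneg),
      ENNReal.ofReal_inv_of_pos (measureReal_G_pos _), ofReal_measureReal (μ_G_ne_top _), μ_G,
      ← ENNReal.zpow_neg, sq, ← ENNReal.zpow_add hp hp']
    congr 1; ring
  have e3 : ‖pair η h‖ₑ = 1 := by rw [← ofReal_norm, norm_pair, ENNReal.ofReal_one]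
  rw [e, Complex.ofReal_mul, enorm_mul, enorm_mul, enorm_mul, e3, mul_one, mul_pow, mul_pow, e1, e2]

/-- The wavelets attached to a coset at a fixed scale form a tight frame for the functions with
spectrum in the dilated coset. -/
theorem tsum_enorm_innerL2_wav_cosetWavelet {f : ℚ_[p] → ℂ} (hf : MemLp f 2 (μ p)) (s : ℕ)
    (η : X p) (n : ℤ) :
    ∑' h : H0 p, ‖innerL2 f (wav (cosetWavelet s η) n h)‖ₑ ^ 2 =
      ∫⁻ χ in dilChar n '' coset (-(s : ℤ)) η, ‖fourier f χ‖ₑ ^ 2 ∂(ν p) := by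
  have hp : (p : ℝ≥0∞) ≠ 0 := by exact_mod_cast (Fact.out : p.Prime).ne_zero
  have hp' : (p : ℝ≥0∞) ≠ ∞ := ENNReal.natCast_ne_top p
  let u : ℚ_[p] → ℂ := fun x => f x * conj (pair (dilChar n η) x)
  let w : ℚ_[p] → ℝ≥0∞ := fun y => ‖∫ x in cell (n - s) y, u x ∂(μ p)‖ₑ ^ 2
  have h1 := tsum_setIntegral_cell u (n - s)
  have h2 := lintegral_eq_tsum_of_invariant n w fun x y hy => by
    simp only [w, cell_add x (G_anti (show n - s ≤ n by omega) hy)]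
  -- The translates run over cosets of `G_n`, but the integrals depend only on the coset of
  -- `G_{n-s}`, each of which contains `p ^ s` of them. Comparing both sums with the integral of `w`
  -- gives this multiplicity, and then `p ^ (n - 2s) * p ^ s = μ(G_{n-s})⁻¹`.
  have h3 : ∑' h : H0 p, w (dil (-n) h) =
      (p : ℝ≥0∞) ^ (s : ℤ) * ∑' h : H0 p, w (dil (-(n - s)) h) := by
    have : μ p (G p n) * ∑' h : H0 p, w (dil (-n) h) =
        μ p (G p (n - s)) * ∑' h : H0 p, w (dil (-(n - s)) h) := h2.symm.trans h1.symm
    rw [μ_G, μ_G] at this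
    calc ∑' h : H0 p, w (dil (-n) h)
        = (p : ℝ≥0∞) ^ n * ((p : ℝ≥0∞) ^ (-n) * ∑' h : H0 p, w (dil (-n) h)) := by
          rw [← mul_assoc, ← ENNReal.zpow_add hp hp']; simp
      _ = _ := by
          rw [this, ← mul_assoc, ← ENNReal.zpow_add hp hp']
          congr 2; ring
  rw [image_dilChar_coset, (isFourier_fourier hf).setLIntegral_coset hf]
  simp only [enorm_innerL2_wav_cosetWavelet]
  rw [ENNReal.tsum_mul_left, neg_add_eq_sub]
  change _ * ∑' h : H0 p, w (dil (-n) h) = _ * ∑' h : H0 p, w (dil (-(n - s)) h)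
  rw [h3, ← mul_assoc, μ_G, ← ENNReal.zpow_neg, ← ENNReal.zpow_add hp hp',
    ← ENNReal.zpow_add hp hp']
  congr 2; ring

/-! ### Bessel families with bound 1 -/

section Bessel

variable {H ι : Type*} [NormedAddCommGroup H] [InnerProductSpace ℂ H] {e : ι → H}

open scoped InnerProductSpace

/-- The synthesis operator of a Bessel family with bound `1` is a contraction. -/
theorem norm_sum_smul_sq_le (hB : ∀ g, ∀ T : Finset ι, ∑ i ∈ T, ‖⟪e i, g⟫_ℂ‖ ^ 2 ≤ ‖g‖ ^ 2)
    (T : Finset ι) (c : ι → ℂ) : ‖∑ i ∈ T, c i • e i‖ ^ 2 ≤ ∑ i ∈ T, ‖c i‖ ^ 2 := by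
  set S := ∑ i ∈ T, c i • e i with hS
  have h1 : ‖S‖ ^ 2 ≤ ∑ i ∈ T, ‖c i‖ * ‖⟪e i, S⟫_ℂ‖ := by
    calc ‖S‖ ^ 2 = ‖⟪S, S⟫_ℂ‖ := by rw [inner_self_eq_norm_sq_to_K]; simp
      _ = ‖∑ i ∈ T, conj (c i) * ⟪e i, S⟫_ℂ‖ := by
        conv_lhs => rw [hS, sum_inner, ← hS]
        simp only [inner_smul_left]
      _ ≤ _ := (norm_sum_le _ _).trans (le_of_eq (by simp))
  have h2 := Finset.sum_mul_sq_le_sq_mul_sq T (fun i => ‖c i‖) fun i => ‖⟪e i, S⟫_ℂ‖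
  -- Bessel's inequality applied to the synthesised vector itself; after Cauchy–Schwarz a factor
  -- `‖S‖ ^ 2` cancels.
  have h3 := hB S T
  have h4 : (‖S‖ ^ 2) ^ 2 ≤ (∑ i ∈ T, ‖c i‖ ^ 2) * ‖S‖ ^ 2 :=
    (pow_le_pow_left₀ (sq_nonneg _) h1 2).trans (h2.trans (by gcongr))
  by_cases h0 : ‖S‖ ^ 2 = 0
  · rw [h0]; exact Finset.sum_nonneg fun i _ => sq_nonneg _
  · have : 0 < ‖S‖ ^ 2 := lt_of_le_of_ne (sq_nonneg _) (Ne.symm h0)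
    rw [sq] at h4
    exact le_of_mul_le_mul_right h4 this

/-- For a Bessel family `e` with bound `1`, the frame series `∑ ⟨e_i, f⟩ e_i` converges
unconditionally, and its distance from `f` is controlled by the defect in Bessel's inequality. -/
theorem exists_hasSum_of_bessel [CompleteSpace H]
    (hB : ∀ g, ∑' i, ‖⟪e i, g⟫_ℂ‖ₑ ^ 2 ≤ ‖g‖ₑ ^ 2) (f : H) :
    ∃ S, HasSum (fun i => ⟪e i, f⟫_ℂ • e i) S ∧
      ‖f - S‖ₑ ^ 2 + ∑' i, ‖⟪e i, f⟫_ℂ‖ₑ ^ 2 ≤ ‖f‖ₑ ^ 2 := by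
  have en : ∀ z : ℂ, ‖z‖ₑ ^ 2 = ENNReal.ofReal (‖z‖ ^ 2) := fun z => by
    rw [ENNReal.ofReal_pow (norm_nonneg _), ofReal_norm]
  have enH : ∀ z : H, ‖z‖ₑ ^ 2 = ENNReal.ofReal (‖z‖ ^ 2) := fun z => by
    rw [ENNReal.ofReal_pow (norm_nonneg _), ofReal_norm]
  have hB' : ∀ g, ∀ T : Finset ι, ∑ i ∈ T, ‖⟪e i, g⟫_ℂ‖ ^ 2 ≤ ‖g‖ ^ 2 := fun g T => by
    have := (ENNReal.sum_le_tsum T).trans (hB g)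
    simp only [en, enH] at this
    rwa [← ENNReal.ofReal_sum_of_nonneg fun _ _ => sq_nonneg _,
      ENNReal.ofReal_le_ofReal_iff (sq_nonneg _)] at this
  set c : ι → ℂ := fun i => ⟪e i, f⟫_ℂ with hc
  have hsum : Summable fun i => ‖c i‖ ^ 2 :=
    summable_of_sum_le (fun i => sq_nonneg _) (hB' f)
  have hS : Summable fun i => c i • e i := by
    rw [summable_iff_vanishing_norm] at hsum ⊢
    intro ε hε
    obtain ⟨s, hs⟩ := hsum (ε ^ 2) (by positivity)
    refine ⟨s, fun t ht => ?_⟩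
    have h1 := hs t ht
    rw [Real.norm_of_nonneg (Finset.sum_nonneg fun i _ => sq_nonneg _)] at h1
    exact lt_of_pow_lt_pow_left₀ 2 hε.le ((norm_sum_smul_sq_le hB' t c).trans_lt h1)
  obtain ⟨S, hS⟩ := hS
  refine ⟨S, hS, ?_⟩
  -- Expanding the square, the cross term contributes `-2 ∑ ‖c i‖ ^ 2` and the synthesis bound at
  -- most `+∑ ‖c i‖ ^ 2`, so one copy is left over.
  have hT : ∀ T : Finset ι, ‖f - ∑ i ∈ T, c i • e i‖ ^ 2 + ∑ i ∈ T, ‖c i‖ ^ 2 ≤ ‖f‖ ^ 2 := by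
    intro T
    have h1 := @norm_sub_sq ℂ H _ _ _ f (∑ i ∈ T, c i • e i)
    have h2 : RCLike.re ⟪f, ∑ i ∈ T, c i • e i⟫_ℂ = ∑ i ∈ T, ‖c i‖ ^ 2 := by
      rw [inner_sum, map_sum]
      refine Finset.sum_congr rfl fun i _ => ?_
      rw [inner_smul_right, ← inner_conj_symm f (e i), RCLike.mul_conj]
      norm_cast
    have h3 := norm_sum_smul_sq_le hB' T c
    rw [h2] at h1
    linarith
  have hlim : ‖f - S‖ ^ 2 + ∑' i, ‖c i‖ ^ 2 ≤ ‖f‖ ^ 2 :=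
    le_of_tendsto (((tendsto_const_nhds.sub hS).norm.pow 2).add hsum.hasSum) (.of_forall hT)
  simp only [en, enH]
  rw [← ENNReal.ofReal_tsum_of_nonneg (fun _ => sq_nonneg _) hsum,
    ← ENNReal.ofReal_add (sq_nonneg _) (tsum_nonneg fun _ => sq_nonneg _)]
  exact ENNReal.ofReal_le_ofReal hlim

end Bessel

/-- `exists_hasSum_of_bessel` for families of functions. -/
theorem exists_hasSumL2_of_bessel {ι : Type*} {e : ι → ℚ_[p] → ℂ}
    (he : ∀ i, MemLp (e i) 2 (μ p))
    (hB : ∀ g, MemLp g 2 (μ p) → ∑' i, ‖innerL2 g (e i)‖ₑ ^ 2 ≤ ∫⁻ x, ‖g x‖ₑ ^ 2 ∂(μ p))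
    {f : ℚ_[p] → ℂ} (hf : MemLp f 2 (μ p)) :
    ∃ S, HasSumL2 (fun i x => innerL2 f (e i) * e i x) S (μ p) ∧
      eLpNorm (fun x => f x - S x) 2 (μ p) ^ 2 + ∑' i, ‖innerL2 f (e i)‖ₑ ^ 2 ≤
        ∫⁻ x, ‖f x‖ₑ ^ 2 ∂(μ p) := by
  have hinner : ∀ g : Lp ℂ 2 (μ p), ∀ i, inner ℂ ((he i).toLp) g = innerL2 g (e i) := by
    intro g i
    rw [L2.inner_def]
    refine integral_congr_ae ?_
    filter_upwards [(he i).coeFn_toLp] with x hx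
    rw [hx]; rfl
  have hnorm : ∀ g : Lp ℂ 2 (μ p), ‖g‖ₑ ^ 2 = ∫⁻ x, ‖g x‖ₑ ^ 2 ∂(μ p) := fun g => by
    rw [Lp.enorm_def, eLpNorm_two_sq]
  have hf' : ∀ i, innerL2 hf.toLp (e i) = innerL2 f (e i) := fun i => by
    refine integral_congr_ae ?_
    filter_upwards [hf.coeFn_toLp] with x hx
    rw [hx]
  obtain ⟨S, hS, hS'⟩ := exists_hasSum_of_bessel (e := fun i => (he i).toLp)
    (fun g => by simpa only [hinner, hnorm] using hB g (Lp.memLp g)) hf.toLp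
  simp only [hinner, hf'] at hS hS'
  refine ⟨S, ⟨Lp.memLp S, ?_⟩, ?_⟩
  · have h := (Lp.tendsto_Lp_iff_tendsto_eLpNorm' _ _).1 hS
    refine h.congr fun T => ?_
    rw [eLpNorm_sub_comm]
    refine eLpNorm_congr_ae ?_
    have h1 : ∀ᵐ x ∂(μ p), ∀ i ∈ T,
        (innerL2 f (e i) • (he i).toLp) x = innerL2 f (e i) * e i x := by
      refine (ae_ball_iff T.countable_toSet).2 fun i _ => ?_
      filter_upwards [Lp.coeFn_smul (innerL2 f (e i)) (he i).toLp, (he i).coeFn_toLp]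
        with x hx hx'
      rw [hx, Pi.smul_apply, hx', smul_eq_mul]
    filter_upwards [h1, Lp.coeFn_finsetSum T fun i => innerL2 f (e i) • (he i).toLp] with x hx hx'
    rw [Pi.sub_apply, hx', Finset.sum_apply, Finset.sum_congr rfl hx]
  · refine le_of_eq_of_le ?_ (hS'.trans_eq ?_)
    · congr 2
      rw [Lp.enorm_def]
      refine eLpNorm_congr_ae ?_
      filter_upwards [Lp.coeFn_sub hf.toLp S, hf.coeFn_toLp] with x hx hx'
      rw [hx, Pi.sub_apply, hx']
    · rw [Lp.enorm_def, eLpNorm_two_sq]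
      refine lintegral_congr_ae ?_
      filter_upwards [hf.coeFn_toLp] with x hx
      rw [hx]

theorem rpow_half_tsum_le {ι : Type*} (b : ι → ℝ≥0∞) :
    (∑' i, b i) ^ (1 / 2 : ℝ) ≤ ∑' i, b i ^ (1 / 2 : ℝ) := by
  set a : ι → ℝ≥0∞ := fun i => b i ^ (1 / 2 : ℝ)
  have ha : ∀ i, b i = a i * a i := fun i => by
    rw [← sq, ← ENNReal.rpow_natCast, ← ENNReal.rpow_mul]; simp
  -- With `b i = a i ^ 2`, bound one factor of each `a i * a i` by the whole sum.
  have h : ∑' i, b i ≤ (∑' i, a i) ^ 2 := by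
    rw [sq, ← ENNReal.tsum_mul_right]
    refine ENNReal.tsum_le_tsum fun i => ?_
    rw [ha i]
    gcongr
    exact ENNReal.le_tsum i
  refine (ENNReal.rpow_le_rpow h (by norm_num)).trans_eq ?_
  rw [← ENNReal.rpow_natCast, ← ENNReal.rpow_mul]; simp

/-! ### The tiling of the dual group -/

variable (p) in
/-- The annulus `G_{a+1}^⊥ \ G_a^⊥`. -/
def annulus (a : ℤ) : Set (X p) := Gperp p (a + 1) \ Gperp p a

theorem dilChar_mem_annulus {k a : ℤ} {χ : X p} :
    dilChar k χ ∈ annulus p (a + k) ↔ χ ∈ annulus p a := by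
  rw [annulus, annulus, Set.mem_sdiff, Set.mem_sdiff, dilChar_mem_Gperp,
    show a + k + 1 = a + 1 + k by ring, dilChar_mem_Gperp]

theorem eq_of_mem_annulus {a b : ℤ} {χ : X p} (ha : χ ∈ annulus p a) (hb : χ ∈ annulus p b) :
    a = b := by
  by_contra hne
  rcases lt_or_gt_of_ne hne with h | h
  · exact hb.2 (Gperp_mono (by omega) ha.1)
  · exact ha.2 (Gperp_mono (by omega) hb.1)

theorem measure_iInter_Gperp : ν p (⋂ n : ℕ, Gperp p (-(n : ℤ))) = 0 := by
  have hlim : Tendsto (fun n : ℕ => ((p : ℝ≥0∞)⁻¹) ^ n) atTop (𝓝 0) :=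
    ENNReal.tendsto_pow_atTop_nhds_zero_of_lt_one
      (ENNReal.inv_lt_one.2 (by exact_mod_cast (Fact.out : p.Prime).one_lt))
  refine le_antisymm (ge_of_tendsto hlim (.of_forall fun n => ?_)) zero_le
  refine (measure_mono (Set.iInter_subset _ n)).trans_eq ?_
  rw [ν_Gperp, μ_G, neg_neg, zpow_natCast, ENNReal.inv_pow]

theorem exists_mem_annulus {χ : X p} (hχ : χ ∉ ⋂ n : ℕ, Gperp p (-(n : ℤ))) :
    ∃ a, χ ∈ annulus p a := by
  obtain ⟨m, hm⟩ : ∃ m : ℕ, χ ∉ Gperp p (-(m : ℤ)) := by simpa using hχ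
  obtain ⟨n, hn⟩ := exists_mem_Gperp χ
  obtain ⟨b, hb, hb'⟩ := Int.exists_least_of_bdd (P := fun z => χ ∈ Gperp p z)
    ⟨-(m : ℤ), fun z hz => by
      by_contra! hlt
      exact hm (Gperp_mono hlt.le hz)⟩ ⟨n, hn⟩
  refine ⟨b - 1, by simpa using hb, fun h => ?_⟩
  have := hb' _ h
  omega

section Tiling

variable {ι : Type*} {t : ι → ℕ} {E : ι → Set (X p)} {M : ℤ}

/-- `E_i A^n` is the tile `E_i A^{t(i)}` dilated by `n - t(i)`, hence inside the annulus of index `M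
+ n - t(i)`. A common point forces equal values of `n - t(i)`; undoing that dilation puts it in two
tiles, so the indices agree. -/
theorem pairwise_disjoint_image_dilChar
    (hdisj : Pairwise fun i j => Disjoint (dilChar (t i : ℤ) '' E i) (dilChar (t j : ℤ) '' E j))
    (htile : ⋃ j, dilChar (t j : ℤ) '' E j = annulus p M) :
    Pairwise (Function.onFun Disjoint fun a : ℤ × ι => dilChar a.1 '' E a.2) := by
  rintro ⟨n, i⟩ ⟨n', i'⟩ hne
  refine Set.disjoint_left.2 fun χ hχ hχ' => hne ?_
  have key : ∀ (n : ℤ) (i : ι), χ ∈ dilChar n '' E i →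
      dilChar (t i - n) χ ∈ dilChar (t i : ℤ) '' E i ∧ χ ∈ annulus p (M + (n - t i)) := by
    intro n i h
    have h1 : dilChar (t i - n) χ ∈ dilChar (t i : ℤ) '' E i := by
      rw [mem_image_dilChar] at h ⊢
      rwa [dilChar_dilChar, show -(t i : ℤ) + (t i - n) = -n by ring]
    refine ⟨h1, ?_⟩
    have h2 : dilChar (t i - n) χ ∈ annulus p M := htile ▸ Set.mem_iUnion_of_mem i h1
    rwa [← dilChar_mem_annulus (k := n - t i), dilChar_dilChar,
      show (n - t i + (t i - n) : ℤ) = 0 by ring, dilChar_zero] at h2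
  obtain ⟨h1, h2⟩ := key n i hχ
  obtain ⟨h1', h2'⟩ := key n' i' hχ'
  have h3 := eq_of_mem_annulus h2 h2'
  have h4 : i = i' := by
    by_contra hii
    refine Set.disjoint_left.1 (hdisj hii) h1 ?_
    rwa [show (t i - n : ℤ) = t i' - n' by omega]
  subst h4
  ext1
  · dsimp only; omega
  · rfl

/-- A character in the annulus of index `a` dilates into the tiled annulus, so it lies in some `E_j
A^{a - M + t(j)}`. If it is left uncovered, then `K < a - M + t(j) ≤ a + l`, and `n = a + l` serves
as the index. -/
theorem compl_iUnion_image_dilChar_subset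
    (htile : ⋃ j, dilChar (t j : ℤ) '' E j = annulus p M) (hM : 0 ≤ M) {l : ℕ}
    (hl : ∀ j, t j ≤ l) (K : ℤ) :
    (⋃ a : Set.Iic K × ι, dilChar (a.1 : ℤ) '' E a.2)ᶜ ⊆
      (⋂ n : ℕ, Gperp p (-(n : ℤ))) ∪ ⋃ n : Set.Ioi K, annulus p (n - l) := by
  intro χ hχ
  by_cases h0 : χ ∈ ⋂ n : ℕ, Gperp p (-(n : ℤ))
  · exact Or.inl h0
  right
  obtain ⟨a, ha⟩ := exists_mem_annulus h0
  have h1 : dilChar (M - a) χ ∈ annulus p M := by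
    have := dilChar_mem_annulus (k := M - a) (a := a) (χ := χ)
    rw [add_sub_cancel] at this
    exact this.2 ha
  rw [← htile, Set.mem_iUnion] at h1
  obtain ⟨j, hj⟩ := h1
  have h2 : χ ∈ dilChar (a - M + t j) '' E j := by
    rw [mem_image_dilChar] at hj ⊢
    rwa [dilChar_dilChar, show -(t j : ℤ) + (M - a) = -(a - M + t j) by ring] at hj
  have h3 : K < a - M + t j := by
    by_contra! hle
    exact hχ (Set.mem_iUnion.2 ⟨(⟨a - M + t j, hle⟩, j), h2⟩)
  have := hl j
  refine Set.mem_iUnion.2 ⟨⟨a + l, Set.mem_Ioi.2 (by omega)⟩, ?_⟩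
  simpa using ha

end Tiling

end PadicFrame

end

/-! ### The approximation estimate -/

theorem theorem3p1 (p : ℕ) [Fact p.Prime] (M N : ℕ) (hM : 1 ≤ M)
    -- a step refinable function
    (φ : ℚ_[p] → ℂ) (hφ : PadicFrame.IsStep M N φ) (hφr : PadicFrame.IsRefinable φ)
    -- masks, cosets and wavelets
    (q : ℕ) (m : Fin q → PadicFrame.X p → ℂ) (hm : ∀ j, PadicFrame.IsMask (m j))
    (s : Fin q → ℕ) (η : Fin q → PadicFrame.X p)
    (hη : ∀ j, η j ∈ PadicFrame.Gperp p ((M : ℤ) + 1))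
    (E : Fin q → Set (PadicFrame.X p))
    (hE : ∀ j, E j = PadicFrame.coset (-(s j : ℤ)) (η j))
    (hmE : ∀ j, (fun χ => PadicFrame.fourier φ (PadicFrame.dilChar (-1) χ) * m j χ)
      =ᵐ[PadicFrame.ν p] (E j).indicator 1)
    (ψ : Fin q → ℚ_[p] → ℂ) (hψL2 : ∀ j, MemLp (ψ j) 2 (PadicFrame.μ p))
    (hψ : ∀ j, PadicFrame.fourier (ψ j)
      =ᵐ[PadicFrame.ν p] fun χ => PadicFrame.fourier φ (PadicFrame.dilChar (-1) χ) * m j χ)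
    -- the dilated cosets tile an annulus
    (t : Fin q → ℕ)
    (hdisj : Pairwise fun i j =>
      Disjoint (PadicFrame.dilChar (t i : ℤ) '' E i) (PadicFrame.dilChar (t j : ℤ) '' E j))
    (htile : ⋃ j, PadicFrame.dilChar (t j : ℤ) '' E j =
      PadicFrame.Gperp p ((M : ℤ) + 1) \ PadicFrame.Gperp p (M : ℤ))
    (l : ℕ) (hl : l = Finset.univ.sup t)
    (f : ℚ_[p] → ℂ) (hf : MemLp f 2 (PadicFrame.μ p)) (Nt : ℤ) (hNt : (N : ℤ) < Nt) :
    ∃ S : ℚ_[p] → ℂ,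
      PadicFrame.HasSumL2
        (fun (i : Set.Iic Nt × Fin q × PadicFrame.H0 p) x =>
          PadicFrame.innerL2 f (PadicFrame.wav (ψ i.2.1) i.1 i.2.2) *
            PadicFrame.wav (ψ i.2.1) i.1 i.2.2 x)
        S (PadicFrame.μ p) ∧
      eLpNorm (fun x => f x - S x) 2 (PadicFrame.μ p) ≤
        ((N : ℝ≥0∞) + 1) * (p : ℝ≥0∞) ^ (((M : ℝ) - 1) / 2) *
          ∑' n : Set.Ioi Nt,
            (∫⁻ χ in PadicFrame.Gperp p ((n : ℤ) - l + 1) \ PadicFrame.Gperp p ((n : ℤ) - l),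
              ‖PadicFrame.fourier f χ‖ₑ ^ 2 ∂(PadicFrame.ν p)) ^ (1 / 2 : ℝ) := by
  open PadicFrame in
  have hψE : ∀ j, ψ j =ᵐ[μ p] cosetWavelet (s j) (η j) := fun j => by
    refine ae_eq_cosetWavelet (hψL2 j) ?_
    rw [← hE j]
    exact (hψ j).trans (hmE j)
  let U : Set.Iic Nt × Fin q → Set (X p) := fun a => dilChar (a.1 : ℤ) '' E a.2
  have hUm : ∀ a, MeasurableSet (U a) := fun a => by
    simp only [U, hE, image_dilChar_coset]
    exact measurableSet_coset _ _
  have hUd : Pairwise (Function.onFun Disjoint U) := fun a b hab =>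
    pairwise_disjoint_image_dilChar hdisj htile
      (i := ((a.1 : ℤ), a.2)) (j := ((b.1 : ℤ), b.2)) fun h => hab (by
        rw [Prod.mk.injEq] at h
        exact Prod.ext (Subtype.ext h.1) h.2)
  -- The tight frame identity on each `E_j A^n`, summed over disjoint spectra; it yields both the
  -- Bessel bound and the exact defect.
  have hsum : ∀ g, MemLp g 2 (μ p) →
      ∑' i : Set.Iic Nt × Fin q × H0 p, ‖innerL2 g (wav (ψ i.2.1) i.1 i.2.2)‖ₑ ^ 2 =
        ∫⁻ χ in ⋃ a, U a, ‖fourier g χ‖ₑ ^ 2 ∂(ν p) := fun g hg => by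
    rw [lintegral_iUnion hUm hUd, ENNReal.tsum_prod', ENNReal.tsum_prod']
    congr 1; ext n
    rw [ENNReal.tsum_prod']
    congr 1; ext j
    simp only [fun h : H0 p => innerL2_congr_ae g (wav_congr_ae (hψE j) n h)]
    rw [tsum_enorm_innerL2_wav_cosetWavelet hg, ← hE j]
  obtain ⟨S, hS, hS'⟩ := exists_hasSumL2_of_bessel
    (e := fun i : Set.Iic Nt × Fin q × H0 p => wav (ψ i.2.1) i.1 i.2.2)
    (fun i => (memLp_wav_cosetWavelet _ _ _ _).ae_eq (wav_congr_ae (hψE i.2.1) _ _).symm)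
    (fun g hg => by
      rw [hsum g hg, ← (isFourier_fourier hg).lintegral_sq hg]
      exact setLIntegral_le_lintegral _ _) hf
  refine ⟨S, hS, ?_⟩
  have hΩ : MeasurableSet (⋃ a, U a) := .iUnion hUm
  have hfin : ∫⁻ χ in ⋃ a, U a, ‖fourier f χ‖ₑ ^ 2 ∂(ν p) ≠ ∞ := by
    refine ne_top_of_le_ne_top ?_ (setLIntegral_le_lintegral _ _)
    rw [(isFourier_fourier hf).lintegral_sq hf, ← eLpNorm_two_sq]
    exact ENNReal.pow_ne_top hf.2.ne
  -- Plancherel splits the energy of `f` into covered and uncovered parts; cancelling the finite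
  -- covered part bounds the squared error by the uncovered one.
  rw [hsum f hf, ← (isFourier_fourier hf).lintegral_sq hf, ← lintegral_add_compl (μ := ν p) _ hΩ, add_comm,
    ENNReal.add_le_add_iff_left hfin] at hS'
  have hcompl : ∫⁻ χ in (⋃ a, U a)ᶜ, ‖fourier f χ‖ₑ ^ 2 ∂(ν p) ≤
      ∑' n : Set.Ioi Nt, ∫⁻ χ in annulus p (n - l), ‖fourier f χ‖ₑ ^ 2 ∂(ν p) := by
    refine (lintegral_mono_set (compl_iUnion_image_dilChar_subset htile (by omega)
      (fun j => hl ▸ Finset.le_sup (Finset.mem_univ j)) Nt)).trans ?_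
    refine (lintegral_union_le _ _ _).trans ?_
    rw [Measure.restrict_eq_zero.2 measure_iInter_Gperp, lintegral_zero_measure, zero_add]
    exact lintegral_iUnion_le _ _
  have hroot : eLpNorm (fun x => f x - S x) 2 (μ p) ≤
      ∑' n : Set.Ioi Nt, (∫⁻ χ in annulus p (n - l), ‖fourier f χ‖ₑ ^ 2 ∂(ν p)) ^ (1 / 2 : ℝ) := by
    refine le_trans ?_ (rpow_half_tsum_le _)
    refine le_of_eq_of_le ?_ (ENNReal.rpow_le_rpow (hS'.trans hcompl) (by norm_num))
    rw [← ENNReal.rpow_natCast, ← ENNReal.rpow_mul]; simp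
  -- The stated constant only has to be at least 1, which holds since `M ≥ 1`.
  refine hroot.trans (le_mul_of_one_le_left' ?_)
  have h1 : (1 : ℝ≥0∞) ≤ (p : ℝ≥0∞) ^ (((M : ℝ) - 1) / 2) := by
    have hp : (1 : ℝ≥0∞) ≤ p := by exact_mod_cast (Fact.out : p.Prime).one_lt.le
    have hM' : (1 : ℝ) ≤ M := by exact_mod_cast hM
    simpa using ENNReal.rpow_le_rpow_of_exponent_le hp
      (show (0 : ℝ) ≤ ((M : ℝ) - 1) / 2 by linarith)
  exact one_le_mul (by simp) h1
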